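/- **Proposition 3.1.** Let $n\ge 1$ and let $K\subset\mathbb H^n$ be a compact, geodesically convex set with non-empty interior in hyperbolic $n$-space. Then $\mathcal H^{n-1}$-almost every point of the boundary $\partial K$ is normal, where $\mathcal H^{n-1}$ is the $(n-1)$-dimensional Hausdorff measure of the hyperbolic distance. Here the notions are as follows. Use the half-space model $\mathbb H^n=\{(\mathbf x,z):\mathbf x\in\mathbb R^{n-1},\,z>0\}$ with metric $z^{-2}(d\mathbf x^2+dz^2)$. A point $q\in\partial K$ is *smooth* if $K$ has exactly one support hyperbolic hyperplane $P$ at $q$. In that case let $\nu_q$ be the exterior unit normal of $K$ at $q$ (orthogonal to $P$). The *interior tangent horosphere* $\mathfrak h_q$ is the horosphere through $q$ that is orthogonal to $\nu_q$ and whose horoball contains the geodesic ray $\exp_q(-t\nu_q)$, $t\ge 0$; this ray lies in $\mathrm{int}(K)$ for small $t>0$. After an isometry of $\mathbb H^n$ we may take $q=(\mathbf 0,1)$ and $\mathfrak h_q=\{z=1\}$, with horoball $\{z\ge 1\}$; then $P$ is the hemisphere $\{|\mathbf x|^2+z^2=1\}$ and $\exp_q(-t\nu_q)=(\mathbf 0,e^{t})$.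 Near $q$ the boundary $\partial K$ is then the graph $\{(\mathbf x,e^{-u_q(\mathbf x)}):|\mathbf x|<\varepsilon\}$ of a function $u_q$ on a ball $\mathbb B_\varepsilon\subset\mathbb R^{n-1}$ that is horoconvex, meaning that $\mathbf x\mapsto e^{-2u_q(\mathbf x)}+|\mathbf x|^2$ is convex, and that satisfies $u_q(\mathbf 0)=0$ and $\nabla_{\mathbf 0}u_q=0$. (The existence of such an isometry and of such a function $u_q$ is part of the assertion.) The point $q$ is *normal* if it is smooth and $u_q$ is two times differentiable at $\mathbf 0$, i.e. there are a vector $g\in\mathbb R^{n-1}$ and a symmetric matrix $Q$ with $$u_q(\mathbf y)=u_q(\mathbf 0)+\langle g,\mathbf y\rangle+\tfrac12\langle Q\mathbf y,\mathbf y\rangle+o(|\mathbf y|^2)\qquad(\mathbf y\to\mathbf 0).$$ -/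

import Mathlib

open scoped Topology

noncomputable section

/-- The half-space model of hyperbolic space of dimension `m + 1`: pairs `(x, z)` with
`x ∈ ℝᵐ` and `z > 0`. -/
@[ext]
structure HypSpace (m : ℕ) where
  x : EuclideanSpace ℝ (Fin m)
  z : ℝ
  z_pos : 0 < z

namespace HypSpace

variable {m : ℕ}

/-- The point `(x, z)` of the Euclidean space `ℝᵐ × ℝ`. -/
def toEuc (p : HypSpace m) : WithLp 2 (EuclideanSpace ℝ (Fin m) × ℝ) :=
  WithLp.toLp 2 (p.x, p.z)

/-- The mirror point `(x, -z)` (auxiliary, for the triangle inequality). -/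
def toEucNeg (p : HypSpace m) : WithLp 2 (EuclideanSpace ℝ (Fin m) × ℝ) :=
  WithLp.toLp 2 (p.x, -p.z)

/-- The hyperbolic distance, i.e. the Riemannian distance of `z⁻² (dx² + dz²)`, in closed form:
`sinh (d(p, q) / 2) = |p - q| / (2 √(z_p z_q))`, with `|p - q|` the Euclidean distance. -/
instance : Dist (HypSpace m) :=
  ⟨fun p q => 2 * Real.arsinh (dist p.toEuc q.toEuc / (2 * √(p.z * q.z)))⟩

theorem dist_eq (p q : HypSpace m) :
    dist p q = 2 * Real.arsinh (dist p.toEuc q.toEuc / (2 * √(p.z * q.z))) := rfl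

theorem dist_toEuc_sq (p q : HypSpace m) :
    dist p.toEuc q.toEuc ^ 2 = ‖p.x - q.x‖ ^ 2 + (p.z - q.z) ^ 2 := by
  rw [dist_eq_norm, WithLp.prod_norm_sq_eq_of_L2]
  simp [toEuc]

theorem dist_toEuc_neg_sq (p q : HypSpace m) :
    dist p.toEuc q.toEucNeg ^ 2 = ‖p.x - q.x‖ ^ 2 + (p.z + q.z) ^ 2 := by
  rw [dist_eq_norm, WithLp.prod_norm_sq_eq_of_L2]
  simp [toEuc, toEucNeg]

theorem sinh_half_dist (p q : HypSpace m) :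
    Real.sinh (dist p q / 2) = dist p.toEuc q.toEuc / (2 * √(p.z * q.z)) := by
  rw [dist_eq, mul_div_cancel_left₀ (Real.arsinh _) two_ne_zero, Real.sinh_arsinh]

theorem cosh_half_dist (p q : HypSpace m) :
    Real.cosh (dist p q / 2) = dist p.toEuc q.toEucNeg / (2 * √(p.z * q.z)) := by
  have hp := p.z_pos
  have hq := q.z_pos
  rw [← sq_eq_sq₀ (Real.cosh_pos _).le (by positivity), Real.cosh_sq', sinh_half_dist, div_pow,
    div_pow, one_add_div (by positivity), mul_pow, Real.sq_sqrt (by positivity), dist_toEuc_sq,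
    dist_toEuc_neg_sq]
  congr 1
  ring

theorem dist_toEucNeg_self (p : HypSpace m) : dist p.toEuc p.toEucNeg = 2 * p.z := by
  have hp := p.z_pos
  rw [← sq_eq_sq₀ dist_nonneg (by positivity), dist_toEuc_neg_sq]
  simp
  ring

protected theorem dist_comm (p q : HypSpace m) : dist p q = dist q p := by
  rw [dist_eq, dist_eq, dist_comm p.toEuc, mul_comm p.z]

protected theorem dist_triangle (a b c : HypSpace m) : dist a c ≤ dist a b + dist b c := by
  have ha := a.z_pos
  have hb := b.z_pos
  have hc := c.z_pos
  have hpt := EuclideanGeometry.mul_dist_le_mul_dist_add_mul_dist a.toEuc b.toEuc c.toEuc b.toEucNeg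
  rw [dist_toEucNeg_self] at hpt
  have hsa := Real.sqrt_pos.2 ha
  have hsb := Real.sqrt_pos.2 hb
  have hsc := Real.sqrt_pos.2 hc
  have hbb : √b.z * √b.z = b.z := Real.mul_self_sqrt hb.le
  rw [← div_le_div_iff_of_pos_right (zero_lt_two' ℝ), ← Real.sinh_le_sinh, add_div, Real.sinh_add,
    sinh_half_dist, sinh_half_dist, sinh_half_dist, cosh_half_dist, HypSpace.cosh_half_dist,
    Real.sqrt_mul ha.le, Real.sqrt_mul ha.le, Real.sqrt_mul hb.le]
  have hflip : dist b.toEuc c.toEucNeg = dist c.toEuc b.toEucNeg := by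
    rw [← sq_eq_sq₀ dist_nonneg dist_nonneg, dist_toEuc_neg_sq, dist_toEuc_neg_sq, norm_sub_rev,
      add_comm b.z]
  rw [hflip]
  have key : dist a.toEuc b.toEuc / (2 * (√a.z * √b.z)) *
        (dist c.toEuc b.toEucNeg / (2 * (√b.z * √c.z))) +
      dist a.toEuc b.toEucNeg / (2 * (√a.z * √b.z)) *
        (dist b.toEuc c.toEuc / (2 * (√b.z * √c.z))) =
      (dist a.toEuc b.toEuc * dist c.toEuc b.toEucNeg +
        dist b.toEuc c.toEuc * dist a.toEuc b.toEucNeg) / (2 * b.z) / (2 * (√a.z * √c.z)) := by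
    generalize √b.z = s at hbb hsb ⊢
    rw [← hbb]
    field_simp
  rw [key]
  gcongr
  rw [le_div_iff₀ (by positivity)]
  exact hpt

instance : MetricSpace (HypSpace m) where
  dist_self p := by rw [dist_eq, dist_self, zero_div, Real.arsinh_zero, mul_zero]
  dist_comm := HypSpace.dist_comm
  dist_triangle := HypSpace.dist_triangle
  eq_of_dist_eq_zero {p q} h := by
    have hp := p.z_pos
    have hq := q.z_pos
    have h1 : dist p.toEuc q.toEuc / (2 * √(p.z * q.z)) = 0 := by
      rw [← sinh_half_dist, h]; simp
    have h2 : dist p.toEuc q.toEuc = 0 := by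
      rcases div_eq_zero_iff.1 h1 with h | h
      · exact h
      · have : 0 < 2 * √(p.z * q.z) := by positivity
        exact absurd h this.ne'
    have h3 := dist_eq_zero.1 h2
    have h4 := congrArg WithLp.ofLp h3
    simp only [toEuc, Prod.mk.injEq] at h4
    exact HypSpace.ext h4.1 h4.2

instance : MeasurableSpace (HypSpace m) := borel _

instance : BorelSpace (HypSpace m) := ⟨rfl⟩

/-- Horospherical coordinates `(ξ, ζ)` relative to the horosphere `{z = 1}`: the point
`(ξ, e^{-ζ})` of the half-space. Here `ξ ↦ horoPoint ξ 0` is an isometry of `ℝᵐ` onto the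
horosphere with its induced metric, and `ζ ↦ horoPoint ξ ζ` is the unit speed geodesic orthogonal
to the horosphere at `(ξ, 1)`. -/
def horoPoint (ξ : EuclideanSpace ℝ (Fin m)) (ζ : ℝ) : HypSpace m :=
  ⟨ξ, Real.exp (-ζ), Real.exp_pos _⟩

end HypSpace

open HypSpace

variable {m : ℕ}

/-- Geodesic convexity in hyperbolic space: with `p` and `q` the set contains the geodesic segment
`{r | d(p, r) + d(r, q) = d(p, q)}`. -/
def IsHypConvex (K : Set (HypSpace m)) : Prop :=
  ∀ p ∈ K, ∀ q ∈ K, ∀ r : HypSpace m, dist p r + dist r q = dist p q → r ∈ K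

/-- The class `𝒦(ℍ^{m+1})`: compact convex sets with non-empty interior. -/
structure IsHypConvexBody (K : Set (HypSpace m)) : Prop where
  isCompact : IsCompact K
  convex : IsHypConvex K
  nonempty_interior : (interior K).Nonempty

/-- `P` is a support hyperplane of `K` at `q`. Hyperbolic hyperplanes are the bisectors
`{p | d(p, a) = d(p, b)}` with `a ≠ b`, and the two closed half-spaces bounded by such a hyperplane
are given by the two inequalities between `d(p, a)` and `d(p, b)`. -/
def IsSupportHyperplane (K : Set (HypSpace m)) (q : HypSpace m) (P : Set (HypSpace m)) : Prop :=
  q ∈ P ∧ ∃ a b : HypSpace m, a ≠ b ∧ P = {p | dist p a = dist p b} ∧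
    K ⊆ {p | dist p a ≤ dist p b}

/-- A smooth boundary point: a boundary point with exactly one support hyperplane. -/
def IsSmoothPoint (K : Set (HypSpace m)) (q : HypSpace m) : Prop :=
  q ∈ frontier K ∧ ∃! P : Set (HypSpace m), IsSupportHyperplane K q P

/-- The isometry `φ` of hyperbolic space carries the interior tangent horosphere of `K` at `q` to
the horosphere `{z = 1}`, with `q` at the origin `(0, 1)` of the latter, so that
`p ↦ φ p` expresses points in the horospherical coordinates of that tangent horosphere.

The interior tangent horosphere is the one through `q` orthogonal to the normal of the support
hyperplane, on the side for which the inward normal geodesic from `q`, which runs into the interior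
of `K`, enters its horoball. The hyperplane tangent to `{z = 1}` at `(0, 1)` is the unit
hemisphere, and the normal geodesic into the horoball `{z ≥ 1}` is `t ↦ (0, eᵗ)`. Such a `φ` is
unique up to a linear isometry of `ℝᵐ` acting on the coordinate `x`. -/
structure IsTangentHoroChart (K : Set (HypSpace m)) (q : HypSpace m)
    (φ : HypSpace m ≃ᵢ HypSpace m) : Prop where
  map_point : φ q = horoPoint 0 0
  map_support : ∀ P : Set (HypSpace m), IsSupportHyperplane K q P →
    φ '' P = {p | ‖p.x‖ ^ 2 + p.z ^ 2 = 1}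
  inward : ∀ᶠ t in 𝓝[>] (0 : ℝ), φ.symm (horoPoint 0 (-t)) ∈ interior K

/-- `u` is horoconvex on the ball `𝔹_ε`: the function `e^{-2u(x)} + |x|²` is convex there. -/
def IsHoroconvexOn (ε : ℝ) (u : EuclideanSpace ℝ (Fin m) → ℝ) : Prop :=
  ConvexOn ℝ (Metric.ball 0 ε) fun x => Real.exp (-2 * u x) + ‖x‖ ^ 2

/-- The graph of `u` over the ball `𝔹_ε`, in horospherical coordinates. -/
def horoGraph (ε : ℝ) (u : EuclideanSpace ℝ (Fin m) → ℝ) : Set (HypSpace m) :=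
  (fun x => horoPoint x (u x)) '' Metric.ball 0 ε

/-- In the horospherical coordinates given by `φ`, the graph of the horoconvex function `u` over
`𝔹_ε` is a relatively open neighbourhood of `q` in `∂K`, and `u(0) = 0`, `∇u(0) = 0`. -/
structure IsHoroParametrization (K : Set (HypSpace m)) (φ : HypSpace m ≃ᵢ HypSpace m)
    (ε : ℝ) (u : EuclideanSpace ℝ (Fin m) → ℝ) : Prop where
  horoconvex : IsHoroconvexOn ε u
  graph_eq : ∃ U : Set (HypSpace m), IsOpen U ∧ φ '' frontier K ∩ U = horoGraph ε u
  map_zero : u 0 = 0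
  gradient_zero : HasGradientAt u 0 0

/-- Two times differentiability at `x`, in the sense of a second order Taylor expansion
`u(y) = u(x) + ⟨g, y - x⟩ + ½ ⟨Q (y - x), y - x⟩ + o(|y - x|²)` with `Q` symmetric. -/
def IsTwiceDiffAt (u : EuclideanSpace ℝ (Fin m) → ℝ) (x : EuclideanSpace ℝ (Fin m)) : Prop :=
  ∃ (g : EuclideanSpace ℝ (Fin m))
    (Q : EuclideanSpace ℝ (Fin m) →L[ℝ] EuclideanSpace ℝ (Fin m)),
    (Q : EuclideanSpace ℝ (Fin m) →ₗ[ℝ] EuclideanSpace ℝ (Fin m)).IsSymmetric ∧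
    (fun y => u y - (u x + inner ℝ g (y - x) + (1 / 2) * inner ℝ (Q (y - x)) (y - x)))
      =o[𝓝 x] fun y => ‖y - x‖ ^ 2

/-- A normal boundary point `q`: it is smooth, and the horoconvex function `u_q` that parametrizes
`∂K` near `q` over the interior tangent horosphere is two times differentiable at the point `0`
corresponding to `q`. The germ of `u_q` at `0` is determined by the chart, and the chart up to a
linear isometry of `ℝᵐ`, so the choices below do not matter. -/
def IsNormalPoint (K : Set (HypSpace m)) (q : HypSpace m) : Prop :=
  IsSmoothPoint K q ∧
  ∃ φ : HypSpace m ≃ᵢ HypSpace m, IsTangentHoroChart K q φ ∧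
  ∃ (ε : ℝ) (u : EuclideanSpace ℝ (Fin m) → ℝ), 0 < ε ∧ IsHoroParametrization K φ ε u ∧
    IsTwiceDiffAt u 0

end

/-!
Almost every boundary point of a hyperbolic convex body `K` is normal.

The map `(x, z) ↦ (x, |x|² + z²)` (`HypSpace.klein`) sends the half-space onto the region above a
paraboloid and geodesics to segments, so it turns `K` into a Euclidean convex body and hyperplanes
into affine hyperplanes (`IsHypConvex.convex_image_klein`, `isSupportHyperplane_iff`). Around a
boundary point, an isometry makes the geodesic from this point to an interior point of `K` vertical;
then the boundary is locally the graph of a function `u` for which `f = e^{-2u} + |x|²` is convex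
(`IsHypConvexBody.exists_horoGraph`).

Alexandrov's theorem (`ConvexOn.hausdorffMeasure_not_second_order_eq_zero`) gives a second order
expansion of `f` at almost every `x`. Its proof follows Minty: the resolvent `x + g ↦ x` of the
subdifferential is a nonexpansive map, hence differentiable almost everywhere by Rademacher's
theorem, and it sends to null sets the points where it is not differentiable or where its derivative
is singular. At all other points it can be inverted to first order, so the subdifferential is
differentiable, and integrating it gives the expansion. Since the graph map is Lipschitz, the
exceptional set on the boundary is a null set too.

At a point `q` where `f` has an expansion there is only one support hyperplane, because `f` is
differentiable (`IsSupportHyperplane.eq_of_hasGradientAt`). The horospherical chart at `q` is another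
one than the chart in which the expansion was found. To pass between them, the expansion is read as
a contact of second order of `∂K` with a hypersurface `{H = 0}` with `dH ≠ 0`
(`HasSecondOrderContact`), a notion invariant under smooth isometries. In the tangent chart
`∂K` is again a graph, the contact with `{H = 0}` makes `u_q` differentiable, with gradient `0` since
`K` lies outside the unit hemisphere, and the second order Taylor expansion of `H` can then be
solved for `u_q` (`isTwiceDiffAt_of_isLittleO`).
-/

noncomputable section

open HypSpace

variable {m : ℕ}

/-! ### Twice differentiability of convex functions almost everywhere -/

section Subgradients

open MeasureTheory Filter Asymptotics

variable {E : Type*} [NormedAddCommGroup E] [InnerProductSpace ℝ E]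

/-- `g` is a subgradient at `x` of the function `f` on the set `X`. -/
def IsSubgradientOn (f : E → ℝ) (X : Set E) (g x : E) : Prop :=
  x ∈ X ∧ ∀ x' ∈ X, f x + inner ℝ g (x' - x) ≤ f x'

theorem IsSubgradientOn.inner_nonneg {f : E → ℝ} {X : Set E} {g x g' x' : E}
    (h : IsSubgradientOn f X g x) (h' : IsSubgradientOn f X g' x') :
    0 ≤ inner ℝ (g - g') (x - x') := by
  have h1 := h.2 x' h'.1
  have h2 := h'.2 x h.1
  have h3 : inner ℝ g (x' - x) = - inner ℝ g (x - x') := by rw [← inner_neg_right, neg_sub]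
  rw [inner_sub_left]
  linarith

/-- The resolvent `x + g ↦ x` of the subdifferential is nonexpansive. -/
theorem IsSubgradientOn.norm_sub_le {f : E → ℝ} {X : Set E} {g x g' x' : E}
    (h : IsSubgradientOn f X g x) (h' : IsSubgradientOn f X g' x') :
    ‖x - x'‖ ≤ ‖(x + g) - (x' + g')‖ := by
  have h1 := h.inner_nonneg h'
  have h2 : inner ℝ ((x + g) - (x' + g')) (x - x') =
      ‖x - x'‖ ^ 2 + inner ℝ (g - g') (x - x') := by
    rw [add_sub_add_comm, inner_add_left, real_inner_self_eq_norm_sq]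
  have h3 := real_inner_le_norm ((x + g) - (x' + g')) (x - x')
  rcases (norm_nonneg (x - x')).eq_or_lt with h0 | h0
  · rw [← h0]; exact norm_nonneg _
  · refine le_of_mul_le_mul_right ?_ h0
    nlinarith

/-- Minty's theorem for a continuous convex function on a compact convex set: every point is of
the form `x + g` with `g` a subgradient at `x`. The point `x` minimizes `f + ½ |· - y|²`. -/
theorem exists_isSubgradientOn_sub {f : E → ℝ} {X : Set E} (hX : IsCompact X)
    (hne : X.Nonempty) (hf : ConvexOn ℝ X f) (hc : ContinuousOn f X) (y : E) :
    ∃ x, IsSubgradientOn f X (y - x) x := by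
  obtain ⟨p, hp, hmin⟩ := hX.exists_isMinOn hne
    (f := fun x => f x + 1 / 2 * ‖x - y‖ ^ 2) (by fun_prop)
  refine ⟨p, hp, fun x hx => ?_⟩
  have key : ∀ t ∈ Set.Ioc (0 : ℝ) 1,
      f p + inner ℝ (y - p) (x - p) - f x ≤ t * (1 / 2 * ‖x - p‖ ^ 2) := by
    rintro t ⟨ht0, ht1⟩
    have hconv := hf.2 hp hx (sub_nonneg.2 ht1) ht0.le (by ring)
    have hmem := hf.1 hp hx (sub_nonneg.2 ht1) ht0.le (by ring)
    have h1 := isMinOn_iff.1 hmin _ hmem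
    have h2 : (1 - t) • p + t • x - y = (p - y) + t • (x - p) := by module
    simp only [h2, norm_add_sq_real, norm_smul, inner_smul_right, smul_eq_mul, Real.norm_eq_abs,
      abs_of_pos ht0] at h1 hconv
    have h3 : inner ℝ (y - p) (x - p) = - inner ℝ (p - y) (x - p) := by
      rw [← inner_neg_left, neg_sub]
    rw [h3]
    refine le_of_mul_le_mul_left ?_ ht0
    nlinarith
  have hlim : Tendsto (fun t : ℝ => t * (1 / 2 * ‖x - p‖ ^ 2)) (𝓝[>] 0) (𝓝 0) := by
    refine tendsto_nhdsWithin_of_tendsto_nhds ?_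
    have : Continuous fun t : ℝ => t * (1 / 2 * ‖x - p‖ ^ 2) := by fun_prop
    simpa using this.tendsto 0
  have := ge_of_tendsto hlim (mem_of_superset (Ioc_mem_nhdsGT one_pos) key)
  linarith

/-- A convex function has a subgradient at every interior point of its domain. -/
theorem exists_isSubgradientOn [FiniteDimensional ℝ E] {f : E → ℝ} {X : Set E}
    (hf : ConvexOn ℝ X f) {x : E} (hx : x ∈ interior X) : ∃ g, IsSubgradientOn f X g x := by
  have hcont : ContinuousOn f (interior X) := hf.continuousOn_interior
  have hfi : ConvexOn ℝ (interior X) f := hf.subset interior_subset hf.1.interior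
  set S : Set (E × ℝ) := {p | p.1 ∈ interior X ∧ f p.1 < p.2} with hS
  have hSo : IsOpen S := by
    have h1 : ContinuousOn (fun p : E × ℝ => p.2 - f p.1) (Prod.fst ⁻¹' interior X) :=
      continuousOn_snd.sub (hcont.comp continuousOn_fst fun p hp => hp)
    convert h1.isOpen_inter_preimage (isOpen_interior.preimage continuous_fst) (isOpen_Ioi (a := 0))
      using 1
    ext p
    simp [hS]
  obtain ⟨ℓ, hℓ⟩ := geometric_hahn_banach_open_point (x := (x, f x))
    hfi.convex_strict_epigraph hSo (fun h => lt_irrefl _ h.2)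
  have hsplit : ∀ (v : E) (w : ℝ), ℓ (v, w) = ℓ (v, 0) + w * ℓ (0, 1) := by
    intro v w
    have : (v, w) = (v, (0 : ℝ)) + w • ((0 : E), (1 : ℝ)) := by simp
    rw [this, map_add, map_smul, smul_eq_mul]
  set c := ℓ (0, 1) with hc
  have hc0 : c < 0 := by
    have h1 := hℓ (x, f x + 1) ⟨hx, by simp⟩
    rw [hsplit, hsplit x (f x)] at h1
    linarith
  have hle : ∀ v ∈ interior X, ℓ (v, 0) + f v * c ≤ ℓ (x, 0) + f x * c := by
    intro v hv
    refine le_of_forall_pos_le_add fun η hη => ?_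
    have h1 := hℓ (v, f v + η / (-c)) ⟨hv, by simpa using div_pos hη (neg_pos.2 hc0)⟩
    rw [hsplit, hsplit x (f x)] at h1
    have : η / (-c) * c = -η := by rw [div_neg, neg_mul, div_mul_cancel₀ _ hc0.ne]
    nlinarith
  set L : E →L[ℝ] ℝ := (-c)⁻¹ • ℓ.comp (ContinuousLinearMap.inl ℝ E ℝ) with hL
  have hLe : ∀ v, ℓ (v, 0) = (-c) * L v := by
    intro v
    have : (-c) ≠ 0 := (neg_pos.2 hc0).ne'
    rw [hL, smul_apply, smul_eq_mul, mul_inv_cancel_left₀ this]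
    simp
  set g : E := (InnerProductSpace.toDual ℝ E).symm L with hg
  have hgi : ∀ v, inner ℝ g v = L v := fun v => by
    rw [hg, InnerProductSpace.toDual_symm_apply]
  refine ⟨g, interior_subset hx, fun x' hx' => ?_⟩
  have hloc : IsMinOn (fun v => f v + inner ℝ (-g) v) X x := by
    refine IsMinOn.of_isLocalMinOn_of_convexOn (interior_subset hx) ?_ ?_
    · refine (IsLocalMin.on (a := x) ?_ X)
      filter_upwards [isOpen_interior.mem_nhds hx] with v hv
      have h1 := hle v hv
      rw [hLe, hLe] at h1
      simp only [inner_neg_left, hgi]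
      nlinarith
    · exact hf.add ((innerₛₗ ℝ (-g)).convexOn hf.1)
  have := isMinOn_iff.1 hloc x' hx'
  simp only [inner_neg_left] at this
  rw [inner_sub_right]
  linarith

/-- At a point of differentiability the subdifferential is continuous. -/
theorem eventually_isSubgradientOn_norm_sub_le {f : E → ℝ} {X : Set E} {x₀ g₀ : E}
    [CompleteSpace E] (hx₀ : x₀ ∈ interior X) (hd : HasGradientAt f g₀ x₀) {η : ℝ} (hη : 0 < η) :
    ∀ᶠ x in 𝓝 x₀, ∀ g, IsSubgradientOn f X g x → x ≠ x₀ → ‖g - g₀‖ ≤ η := by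
  have h1 := (hasGradientAt_iff_isLittleO.1 hd).bound (show 0 < η / 3 by positivity)
  obtain ⟨δ, hδ, hball⟩ := Metric.eventually_nhds_iff_ball.1
    (h1.and (isOpen_interior.mem_nhds hx₀))
  refine Metric.eventually_nhds_iff_ball.2 ⟨δ / 2, by positivity, fun x hx g hg hne => ?_⟩
  rw [mem_ball_iff_norm] at hx
  have hr : 0 < ‖x - x₀‖ := norm_pos_iff.2 (sub_ne_zero.2 hne)
  rcases eq_or_ne (g - g₀) 0 with h0 | h0
  · rw [h0, norm_zero]; exact hη.le
  have hG : 0 < ‖g - g₀‖ := norm_pos_iff.2 h0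
  -- test the subgradient inequality at distance `‖x - x₀‖` from `x` in the direction `g - g₀`
  set v : E := (‖x - x₀‖ / ‖g - g₀‖) • (g - g₀) with hv
  have hvn : ‖v‖ = ‖x - x₀‖ := by
    rw [hv, norm_smul, Real.norm_of_nonneg (by positivity), div_mul_cancel₀ _ hG.ne']
  have hvi : inner ℝ (g - g₀) v = ‖x - x₀‖ * ‖g - g₀‖ := by
    rw [hv, inner_smul_right, real_inner_self_eq_norm_sq]
    field_simp
  have hsub : ‖x + v - x₀‖ ≤ 2 * ‖x - x₀‖ := by
    rw [add_sub_right_comm]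
    linarith [norm_add_le (x - x₀) v]
  obtain ⟨hb1, -⟩ := hball x (by rw [mem_ball_iff_norm]; linarith)
  obtain ⟨hb2, hb2X⟩ := hball (x + v) (by rw [mem_ball_iff_norm]; linarith)
  have h2 := hg.2 (x + v) (interior_subset hb2X)
  rw [add_sub_cancel_left] at h2
  rw [Real.norm_eq_abs, abs_le] at hb1 hb2
  have e1 : inner ℝ g₀ (x + v - x₀) = inner ℝ g₀ (x - x₀) + inner ℝ g₀ v := by
    rw [← inner_add_right, add_sub_right_comm]
  rw [inner_sub_left] at hvi
  refine le_of_mul_le_mul_left ?_ hr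
  nlinarith [hb1.1, hb1.2, hb2.1, hb2.2, norm_nonneg (x + v - x₀)]

theorem IsSubgradientOn.eq_of_hasGradientAt {f : E → ℝ} {X : Set E} {x₀ g₀ g : E}
    [CompleteSpace E] (hx₀ : x₀ ∈ interior X) (hd : HasGradientAt f g₀ x₀)
    (hg : IsSubgradientOn f X g x₀) : g = g₀ := by
  have hmin : IsLocalMin (fun v => f v - inner ℝ g v) x₀ := by
    filter_upwards [isOpen_interior.mem_nhds hx₀] with v hv
    have := hg.2 v (interior_subset hv)
    rw [inner_sub_right] at this
    linarith
  have h1 := hmin.hasFDerivAt_eq_zero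
    (hd.hasFDerivAt.sub (InnerProductSpace.toDual ℝ E g).hasFDerivAt)
  rw [← map_sub, map_eq_zero_iff _ (InnerProductSpace.toDual ℝ E).injective] at h1
  exact (sub_eq_zero.1 h1).symm

/-- If the resolvent `p` of the subdifferential is differentiable at `x₀ + g₀` with invertible
derivative `A`, then the subdifferential is differentiable at `x₀` with derivative `A⁻¹ - 1`. -/
theorem eventually_isSubgradientOn_norm_sub_sub_le {f : E → ℝ} {X : Set E} {x₀ g₀ : E}
    [CompleteSpace E] (hx₀ : x₀ ∈ interior X) (hd : HasGradientAt f g₀ x₀) {p : E → E}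
    (hp : ∀ g x, IsSubgradientOn f X g x → p (x + g) = x) {A : E ≃L[ℝ] E}
    (hA : HasFDerivAt p (A : E →L[ℝ] E) (x₀ + g₀)) (hp₀ : p (x₀ + g₀) = x₀) {η : ℝ} (hη : 0 < η) :
    ∀ᶠ x in 𝓝 x₀, ∀ g, IsSubgradientOn f X g x →
      ‖g - g₀ - ((A.symm : E →L[ℝ] E) - 1) (x - x₀)‖ ≤ η * ‖x - x₀‖ := by
  -- the filter of pairs `(x, g)` in the graph of the subdifferential with `x → x₀`
  set l : Filter (E × E) := comap Prod.fst (𝓝 x₀) ⊓ 𝓟 {q | IsSubgradientOn f X q.2 q.1} with hl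
  have hlx : Tendsto Prod.fst l (𝓝 x₀) := tendsto_comap.mono_left inf_le_left
  have hlg : Tendsto Prod.snd l (𝓝 g₀) := by
    refine Metric.tendsto_nhds.2 fun ε hε => ?_
    have h1 := eventually_isSubgradientOn_norm_sub_le hx₀ hd (half_pos hε)
    rw [hl, eventually_inf_principal]
    filter_upwards [h1.comap Prod.fst] with q hq hqs
    rcases eq_or_ne q.1 x₀ with h | h
    · rw [h] at hqs
      rw [hqs.eq_of_hasGradientAt hx₀ hd, dist_self]
      exact hε
    · rw [dist_eq_norm]
      linarith [hq q.2 hqs h]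
  have h1 := hA.isLittleO.comp_tendsto (hlx.add hlg)
  have hmem : ∀ᶠ q in l, IsSubgradientOn f X q.2 q.1 := mem_inf_of_right (mem_principal_self _)
  have h2 : (fun q : E × E => (q.1 - x₀) - A (q.1 + q.2 - (x₀ + g₀))) =o[l]
      fun q => q.1 + q.2 - (x₀ + g₀) := by
    refine h1.congr' ?_ EventuallyEq.rfl
    filter_upwards [hmem] with q hq
    simp [Function.comp, hp _ _ hq, hp₀]
  have h3 : (fun q : E × E => A.symm (q.1 - x₀) - (q.1 + q.2 - (x₀ + g₀))) =o[l]
      fun q => q.1 + q.2 - (x₀ + g₀) := by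
    refine IsBigO.trans_isLittleO ?_ h2
    refine ((A.symm : E →L[ℝ] E).isBigO_comp _ l).congr_left fun q => ?_
    simp only [ContinuousLinearEquiv.coe_coe, map_sub A.symm _ (A _), A.symm_apply_apply]
  have h4 : (fun q : E × E => q.1 + q.2 - (x₀ + g₀)) =O[l] fun q => q.1 - x₀ := by
    have := h3.right_isBigO_add
    simp only [sub_add_cancel] at this
    exact this.trans ((A.symm : E →L[ℝ] E).isBigO_comp _ l)
  have h5 := (h3.trans_isBigO h4).bound hη
  rw [hl, eventually_inf_principal, eventually_comap] at h5
  filter_upwards [h5] with x hx g hg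
  refine le_trans (le_of_eq ?_) (hx (x, g) rfl hg)
  rw [← norm_neg]
  congr 1
  simp only [sub_apply, ContinuousLinearEquiv.coe_coe, one_apply_eq_self]
  abel

/-- One-dimensional integration of an approximately affine subgradient `s`. -/
theorem abs_sub_sub_le_of_subgradient_affine {ψ s : ℝ → ℝ} {a b η : ℝ}
    (hψ : ∀ t ∈ Set.Icc (0 : ℝ) 1, ∀ t' ∈ Set.Icc (0 : ℝ) 1, ψ t + s t * (t' - t) ≤ ψ t')
    (hs : ∀ t ∈ Set.Icc (0 : ℝ) 1, |s t - (a + b * t)| ≤ η) :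
    |ψ 1 - ψ 0 - a - b / 2| ≤ η := by
  -- the increments over a partition into `n` intervals are estimated up to `O(n⁻²)`
  have step : ∀ n : ℕ, 0 < n → ∀ k : ℕ, k ≤ n →
      |ψ (k / n) - ψ 0 - a * (k / n) - b / 2 * (k / n) ^ 2| ≤
        k * (η / n + |b| / 2 * (1 / n) ^ 2) := by
    intro n hn k
    have hn' : (0 : ℝ) < n := by exact_mod_cast hn
    induction k with
    | zero => simp
    | succ k ih =>
      intro hk
      have ih := ih (by omega)
      have hk' : (k : ℝ) + 1 ≤ n := by exact_mod_cast hk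
      set t : ℝ := k / n with ht
      set d : ℝ := 1 / n with hd
      have hd0 : 0 < d := by positivity
      have htd : ((k + 1 : ℕ) : ℝ) / n = t + d := by push_cast; rw [add_div]
      have ht0 : 0 ≤ t := by positivity
      have ht1 : t + d ≤ 1 := by rw [← htd, div_le_one hn']; exact_mod_cast hk
      have m1 : t ∈ Set.Icc (0 : ℝ) 1 := ⟨ht0, by linarith⟩
      have m2 : t + d ∈ Set.Icc (0 : ℝ) 1 := ⟨by linarith, ht1⟩
      have e1 := hψ _ m1 _ m2
      have e2 := hψ _ m2 _ m1
      have f1 := abs_le.1 (hs _ m1)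
      have f2 := abs_le.1 (hs _ m2)
      have hη : η / n = η * d := by rw [hd, mul_one_div]
      rw [htd]
      push_cast
      rw [hη] at ih ⊢
      rw [abs_le] at ih ⊢
      have g1 := mul_le_mul_of_nonneg_right f1.1 hd0.le
      have g2 := mul_le_mul_of_nonneg_right f2.2 hd0.le
      have k1 := mul_le_mul_of_nonneg_right (neg_abs_le b) (sq_nonneg d)
      have k2 := mul_le_mul_of_nonneg_right (le_abs_self b) (sq_nonneg d)
      constructor <;> nlinarith [ih.1, ih.2]
  have hlim : Tendsto (fun n : ℕ => η + |b| / 2 * (1 / (n : ℝ))) atTop (𝓝 η) := by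
    simpa using (tendsto_one_div_atTop_nhds_zero_nat.const_mul (|b| / 2)).const_add η
  refine ge_of_tendsto hlim ?_
  filter_upwards [eventually_gt_atTop 0] with n hn
  have hn' : (n : ℝ) ≠ 0 := by positivity
  have h1 := step n hn n le_rfl
  rw [div_self hn', one_pow, mul_one, mul_one] at h1
  refine h1.trans_eq ?_
  field_simp

/-- If the subdifferential is differentiable at `x₀`, in the sense of a first order expansion
valid for all subgradients, then the function has a second order expansion there. -/
theorem isLittleO_of_subgradient_expansion [FiniteDimensional ℝ E] {f : E → ℝ} {X : Set E}
    {x₀ g₀ : E} {B : E →L[ℝ] E} (hf : ConvexOn ℝ X f) (hx₀ : x₀ ∈ interior X)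
    (hB : ∀ η > 0, ∀ᶠ x in 𝓝 x₀, ∀ g, IsSubgradientOn f X g x →
      ‖g - g₀ - B (x - x₀)‖ ≤ η * ‖x - x₀‖) :
    (fun y => f y - (f x₀ + inner ℝ g₀ (y - x₀) + (1 / 2) * inner ℝ (B (y - x₀)) (y - x₀)))
      =o[𝓝 x₀] fun y => ‖y - x₀‖ ^ 2 := by
  refine IsLittleO.of_bound fun η hη => ?_
  obtain ⟨δ, hδ, hball⟩ := Metric.eventually_nhds_iff_ball.1
    ((hB η hη).and (isOpen_interior.mem_nhds hx₀))
  refine Metric.eventually_nhds_iff_ball.2 ⟨δ, hδ, fun y hy => ?_⟩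
  rw [mem_ball_iff_norm] at hy
  set h := y - x₀ with hh
  have hseg : ∀ t ∈ Set.Icc (0 : ℝ) 1, x₀ + t • h ∈ Metric.ball x₀ δ := by
    rintro t ⟨ht0, ht1⟩
    rw [mem_ball_iff_norm, add_sub_cancel_left, norm_smul, Real.norm_of_nonneg ht0]
    nlinarith [norm_nonneg h]
  have hex : ∀ t : ℝ, ∃ g, t ∈ Set.Icc (0 : ℝ) 1 → IsSubgradientOn f X g (x₀ + t • h) := by
    intro t
    by_cases ht : t ∈ Set.Icc (0 : ℝ) 1
    · obtain ⟨g, hg⟩ := exists_isSubgradientOn hf (hball _ (hseg t ht)).2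
      exact ⟨g, fun _ => hg⟩
    · exact ⟨0, fun h => absurd h ht⟩
  choose g hg using hex
  have key := abs_sub_sub_le_of_subgradient_affine (ψ := fun t => f (x₀ + t • h))
    (s := fun t => inner ℝ (g t) h) (a := inner ℝ g₀ h) (b := inner ℝ (B h) h)
    (η := η * ‖h‖ ^ 2) ?_ ?_
  · simp only [one_smul, zero_smul, add_zero, hh, add_sub_cancel] at key
    rw [Real.norm_eq_abs, Real.norm_of_nonneg (sq_nonneg _)]
    refine le_trans (le_of_eq ?_) key
    congr 1
    ring
  · intro t ht t' ht'
    have h1 := (hg t ht).2 _ (interior_subset (hball _ (hseg t' ht')).2)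
    rwa [add_sub_add_left_eq_sub, ← sub_smul, inner_smul_right, mul_comm] at h1
  · intro t ht
    have h1 := (hball _ (hseg t ht)).1 _ (hg t ht)
    rw [add_sub_cancel_left, map_smul, norm_smul, Real.norm_of_nonneg ht.1] at h1
    have h2 := abs_real_inner_le_norm (g t - g₀ - t • B h) h
    rw [inner_sub_left, inner_sub_left, inner_smul_left] at h2
    have h3 : inner ℝ (g t) h - (inner ℝ g₀ h + inner ℝ (B h) h * t) =
        inner ℝ (g t) h - inner ℝ g₀ h - (starRingEnd ℝ) t * inner ℝ (B h) h := by
      simp; ring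
    rw [h3]
    refine h2.trans ?_
    have h4 : η * (t * ‖h‖) ≤ η * ‖h‖ := by
      have := mul_le_mul_of_nonneg_right ht.2 (norm_nonneg h)
      rw [one_mul] at this
      gcongr
    calc _ ≤ η * ‖h‖ * ‖h‖ := by gcongr; exact h1.trans h4
      _ = _ := by ring

/-- **Alexandrov's theorem**: a Lipschitz convex function on a compact convex set has a second
order expansion at almost every interior point. -/
theorem ConvexOn.hausdorffMeasure_not_second_order_eq_zero [FiniteDimensional ℝ E]
    [MeasurableSpace E] [BorelSpace E] {f : E → ℝ} {X : Set E} {C : NNReal}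
    (hX : IsCompact X) (hf : ConvexOn ℝ X f) (hL : LipschitzOnWith C f X) :
    Measure.hausdorffMeasure (Module.finrank ℝ E : ℝ)
      {x ∈ interior X | ¬ ∃ (g : E) (B : E →L[ℝ] E), HasGradientAt f g x ∧
        (fun y => f y - (f x + inner ℝ g (y - x) + (1 / 2) * inner ℝ (B (y - x)) (y - x)))
          =o[𝓝 x] fun y => ‖y - x‖ ^ 2} = 0 := by
  set μ : Measure E := Measure.hausdorffMeasure (Module.finrank ℝ E : ℝ) with hμ
  rcases X.eq_empty_or_nonempty with rfl | hne
  · simp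
  choose p hp using exists_isSubgradientOn_sub hX hne hf hL.continuousOn
  have hpu : ∀ g x, IsSubgradientOn f X g x → p (x + g) = x := by
    intro g x h
    have h1 := (hp (x + g)).norm_sub_le h
    rw [add_sub_cancel, sub_self, norm_zero] at h1
    exact sub_eq_zero.1 (norm_le_zero_iff.1 h1)
  have hpL : LipschitzWith 1 p := by
    refine LipschitzWith.of_dist_le_mul fun y y' => ?_
    have h1 := (hp y).norm_sub_le (hp y')
    rwa [add_sub_cancel, add_sub_cancel, ← dist_eq_norm, ← dist_eq_norm, ← one_mul (dist y y')]
      at h1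
  have hN1 : μ (p '' {y | ¬ DifferentiableAt ℝ p y}) = 0 := by
    have h1 : μ {y | ¬ DifferentiableAt ℝ p y} = 0 := hpL.ae_differentiableAt
    have h2 := hpL.hausdorffMeasure_image_le (d := Module.finrank ℝ E) (Nat.cast_nonneg _)
      {y | ¬ DifferentiableAt ℝ p y}
    rw [← hμ, h1, mul_zero] at h2
    exact le_antisymm h2 zero_le
  have hN2 : μ (p '' {y | DifferentiableAt ℝ p y ∧ (fderiv ℝ p y).det = 0}) = 0 :=
    addHaar_image_eq_zero_of_det_fderivWithin_eq_zero μ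
      (fun y hy => hy.1.hasFDerivAt.hasFDerivWithinAt) fun y hy => hy.2
  have hN3 : μ {x | ¬ (x ∈ X → DifferentiableWithinAt ℝ f X x)} = 0 :=
    hL.ae_differentiableWithinAt_of_mem
  refine measure_mono_null ?_ (measure_union_null (measure_union_null hN1 hN2) hN3)
  rintro x ⟨hx, hbad⟩
  by_contra hgood
  simp only [Set.mem_union, not_or] at hgood
  obtain ⟨⟨h1, h2⟩, h3⟩ := hgood
  have hfd : DifferentiableAt ℝ f x :=
    (not_not.1 h3 (interior_subset hx)).differentiableAt (mem_interior_iff_mem_nhds.1 hx)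
  have hgrad := hfd.hasGradientAt
  obtain ⟨g, hg⟩ := exists_isSubgradientOn hf hx
  obtain rfl := hg.eq_of_hasGradientAt hx hgrad
  have hpx := hpu _ _ hg
  have hpd : DifferentiableAt ℝ p (x + gradient f x) := by
    by_contra h
    exact h1 ⟨_, h, hpx⟩
  have hdet : (fderiv ℝ p (x + gradient f x)).det ≠ 0 := fun h => h2 ⟨_, ⟨hpd, h⟩, hpx⟩
  set A := (fderiv ℝ p (x + gradient f x)).toContinuousLinearEquivOfDetNeZero hdet with hA
  have hAd : HasFDerivAt p (A : E →L[ℝ] E) (x + gradient f x) := by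
    rw [hA, ContinuousLinearMap.coe_toContinuousLinearEquivOfDetNeZero]
    exact hpd.hasFDerivAt
  exact hbad ⟨_, _, hgrad, isLittleO_of_subgradient_expansion hf hx fun η hη =>
    eventually_isSubgradientOn_norm_sub_sub_le hx hgrad hpu hAd hpx hη⟩

end Subgradients

/-! ### Horospherical coordinates and the projective model -/

namespace HypSpace

theorem cosh_dist (p q : HypSpace m) :
    Real.cosh (dist p q) = (‖p.x - q.x‖ ^ 2 + p.z ^ 2 + q.z ^ 2) / (2 * p.z * q.z) := by
  have hp := p.z_pos
  have hq := q.z_pos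
  have h1 : dist p q = 2 * (dist p q / 2) := by ring
  rw [h1, Real.cosh_two_mul, Real.cosh_sq, sinh_half_dist, div_pow, mul_pow,
    Real.sq_sqrt (by positivity), dist_toEuc_sq]
  field_simp
  ring

theorem dist_le_dist_iff_cosh {p q p' q' : HypSpace m} :
    dist p q ≤ dist p' q' ↔ Real.cosh (dist p q) ≤ Real.cosh (dist p' q') := by
  rw [Real.cosh_le_cosh, abs_of_nonneg dist_nonneg, abs_of_nonneg dist_nonneg]

theorem dist_eq_of_cosh {p q : HypSpace m} {d : ℝ} (hd : 0 ≤ d)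
    (h : Real.cosh (dist p q) = Real.cosh d) : dist p q = d := by
  exact Real.cosh_strictMonoOn.injOn (show dist p q ∈ Set.Ici 0 from dist_nonneg)
    (show d ∈ Set.Ici 0 from hd) h

/-- Horospherical coordinates of a point relative to the horosphere `{z = 1}`. -/
def horoCoord (p : HypSpace m) : EuclideanSpace ℝ (Fin m) × ℝ := (p.x, -Real.log p.z)

@[simp] theorem horoPoint_x (ξ : EuclideanSpace ℝ (Fin m)) (ζ : ℝ) : (horoPoint ξ ζ).x = ξ := rfl

@[simp] theorem horoPoint_z (ξ : EuclideanSpace ℝ (Fin m)) (ζ : ℝ) :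
    (horoPoint ξ ζ).z = Real.exp (-ζ) := rfl

theorem horoPoint_horoCoord (p : HypSpace m) :
    horoPoint p.horoCoord.1 p.horoCoord.2 = p := by
  ext1
  · rfl
  · simp [horoCoord, Real.exp_log p.z_pos]

theorem horoCoord_horoPoint (v : EuclideanSpace ℝ (Fin m) × ℝ) :
    horoCoord (horoPoint v.1 v.2) = v := by
  simp [horoCoord]

theorem continuous_horoPoint :
    Continuous fun v : EuclideanSpace ℝ (Fin m) × ℝ => horoPoint v.1 v.2 := by
  rw [continuous_iff_continuousAt]
  intro v
  rw [ContinuousAt, tendsto_iff_dist_tendsto_zero]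
  have h : Continuous fun w : EuclideanSpace ℝ (Fin m) × ℝ =>
      dist (horoPoint w.1 w.2) (horoPoint v.1 v.2) := by
    simp only [dist_eq, toEuc, horoPoint]
    refine continuous_const.mul (Real.continuous_arsinh.comp (Continuous.div ?_ ?_ ?_))
    · refine Continuous.dist ((WithLp.prod_continuous_toLp 2 _ _).comp ?_) continuous_const
      fun_prop
    · fun_prop
    · intro w
      have := Real.exp_pos (-w.2)
      have := Real.exp_pos (-v.2)
      positivity
  simpa using h.tendsto v

theorem abs_log_sub_log_le_dist (p q : HypSpace m) :
    |Real.log p.z - Real.log q.z| ≤ dist p q := by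
  have hp := p.z_pos
  have hq := q.z_pos
  rw [← abs_of_nonneg (dist_nonneg (x := p) (y := q)), ← Real.cosh_le_cosh, cosh_dist,
    Real.cosh_eq, neg_sub, Real.exp_sub, Real.exp_sub, Real.exp_log hp, Real.exp_log hq]
  have : (p.z / q.z + q.z / p.z) / 2 = (p.z ^ 2 + q.z ^ 2) / (2 * p.z * q.z) := by
    field_simp
  rw [this]
  gcongr
  nlinarith [sq_nonneg ‖p.x - q.x‖]

theorem continuous_horoCoord : Continuous (horoCoord (m := m)) := by
  have hlog : Continuous fun p : HypSpace m => Real.log p.z := by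
    refine (LipschitzWith.of_dist_le_mul (K := 1) fun p q => ?_).continuous
    simpa [Real.dist_eq] using abs_log_sub_log_le_dist p q
  have hz : Continuous fun p : HypSpace m => p.z := by
    refine (Real.continuous_exp.comp hlog).congr fun p => ?_
    simp [Real.exp_log p.z_pos]
  have hx : Continuous fun p : HypSpace m => p.x := by
    rw [continuous_iff_continuousAt]
    intro p
    rw [ContinuousAt, tendsto_iff_norm_sub_tendsto_zero]
    have h1 : Continuous fun q : HypSpace m =>
        √(2 * q.z * p.z * (Real.cosh (dist q p) - 1)) := by
      have := Real.continuous_cosh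
      fun_prop
    have h2 := h1.tendsto p
    simp only [dist_self, Real.cosh_zero, sub_self, mul_zero, Real.sqrt_zero] at h2
    refine squeeze_zero (fun _ => norm_nonneg _) (fun q => ?_) h2
    have hp := p.z_pos
    have hq := q.z_pos
    refine Real.le_sqrt_of_sq_le ?_
    rw [cosh_dist, mul_sub, mul_div_cancel₀ _ (by positivity)]
    nlinarith [sq_nonneg (q.z - p.z)]
  exact hx.prodMk hlog.neg

/-- Horospherical coordinates are global coordinates. -/
def horoHomeo : HypSpace m ≃ₜ EuclideanSpace ℝ (Fin m) × ℝ where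
  toFun := horoCoord
  invFun v := horoPoint v.1 v.2
  left_inv := horoPoint_horoCoord
  right_inv := horoCoord_horoPoint
  continuous_toFun := continuous_horoCoord
  continuous_invFun := continuous_horoPoint

theorem continuous_x : Continuous fun p : HypSpace m => p.x :=
  continuous_fst.comp continuous_horoCoord

theorem continuous_z : Continuous fun p : HypSpace m => p.z := by
  refine (Real.continuous_exp.comp (continuous_snd.comp continuous_horoCoord).neg).congr fun p => ?_
  simp [horoCoord, Real.exp_log p.z_pos]

/-- The projective (Klein) model of hyperbolic space over the paraboloid `w > |x|²`: the map
`(x, z) ↦ (x, |x|² + z²)` straightens geodesics, and it carries the function `e^{-2u} + |x|²` to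
the height function of the graph of `u`. -/
def klein (p : HypSpace m) : EuclideanSpace ℝ (Fin m) × ℝ := (p.x, ‖p.x‖ ^ 2 + p.z ^ 2)

theorem continuous_klein : Continuous (klein (m := m)) := by
  have h1 := continuous_x (m := m)
  have h2 := continuous_z (m := m)
  unfold klein
  fun_prop

/-- The inverse of the projective model on the paraboloid region, with junk values elsewhere. -/
def kleinInv (v : EuclideanSpace ℝ (Fin m) × ℝ) : HypSpace m :=
  horoPoint v.1 (-(Real.log (v.2 - ‖v.1‖ ^ 2) / 2))

theorem klein_kleinInv {v : EuclideanSpace ℝ (Fin m) × ℝ} (hv : ‖v.1‖ ^ 2 < v.2) :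
    klein (kleinInv v) = v := by
  have h : Real.exp (Real.log (v.2 - ‖v.1‖ ^ 2) / 2) ^ 2 = v.2 - ‖v.1‖ ^ 2 := by
    rw [← Real.exp_nat_mul]
    push_cast
    rw [mul_div_cancel₀ _ two_ne_zero, Real.exp_log (sub_pos.2 hv)]
  simp [klein, kleinInv, h]

theorem klein_mem (p : HypSpace m) : ‖(klein p).1‖ ^ 2 < (klein p).2 := by
  have := p.z_pos
  simp only [klein]
  nlinarith

theorem klein_injective : Function.Injective (klein (m := m)) := by
  intro p q h
  simp only [klein, Prod.mk.injEq] at h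
  obtain ⟨h1, h2⟩ := h
  rw [h1, add_right_inj, sq_eq_sq₀ p.z_pos.le q.z_pos.le] at h2
  exact HypSpace.ext h1 h2

theorem kleinInv_klein (p : HypSpace m) : kleinInv (klein p) = p :=
  klein_injective (klein_kleinInv (klein_mem p))

theorem isOpen_image_klein {U : Set (HypSpace m)} (hU : IsOpen U) : IsOpen (klein '' U) := by
  have h1 : IsOpen {v : EuclideanSpace ℝ (Fin m) × ℝ | ‖v.1‖ ^ 2 < v.2} :=
    isOpen_lt (by fun_prop) (by fun_prop)
  have h2 : ContinuousOn (kleinInv (m := m)) {v | ‖v.1‖ ^ 2 < v.2} := by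
    refine continuous_horoPoint.comp_continuousOn (f := fun v : EuclideanSpace ℝ (Fin m) × ℝ =>
      (v.1, -(Real.log (v.2 - ‖v.1‖ ^ 2) / 2))) ?_
    refine continuousOn_fst.prodMk ((ContinuousOn.div_const (ContinuousOn.log ?_ ?_) 2).neg)
    · fun_prop
    · exact fun v hv => (sub_pos.2 hv).ne'
  convert h2.isOpen_inter_preimage h1 hU using 1
  ext v
  constructor
  · rintro ⟨p, hp, rfl⟩
    exact ⟨klein_mem p, by rwa [Set.mem_preimage, kleinInv_klein]⟩
  · rintro ⟨hv, hv'⟩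
    exact ⟨_, hv', klein_kleinInv hv⟩

theorem klein_mem_interior_image_iff {K : Set (HypSpace m)} {p : HypSpace m} :
    klein p ∈ interior (klein '' K) ↔ p ∈ interior K := by
  constructor
  · intro h
    refine mem_interior.2 ⟨klein ⁻¹' interior (klein '' K), fun q hq => ?_,
      isOpen_interior.preimage continuous_klein, h⟩
    obtain ⟨q', hq', he⟩ := interior_subset hq
    rwa [← klein_injective he]
  · intro h
    exact interior_maximal (Set.image_mono interior_subset) (isOpen_image_klein isOpen_interior)
      ⟨p, h, rfl⟩

/-- Segments of the projective model are geodesic segments. -/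
theorem dist_add_dist_of_klein_mem_segment {p q r : HypSpace m} {a b : ℝ} (ha : 0 ≤ a)
    (hb : 0 ≤ b) (hab : a + b = 1) (hr : klein r = a • klein p + b • klein q) :
    dist p r + dist r q = dist p q := by
  have hp := p.z_pos
  have hq := q.z_pos
  have hrz := r.z_pos
  simp only [klein, Prod.smul_mk, Prod.mk_add_mk, Prod.mk.injEq, smul_eq_mul] at hr
  obtain ⟨hx, hw⟩ := hr
  set c := Real.cosh (dist p q) with hc
  set s := Real.sinh (dist p q) with hs
  have hcs : c ^ 2 = s ^ 2 + 1 := Real.cosh_sq _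
  have hs0 : 0 ≤ s := Real.sinh_nonneg_iff.2 dist_nonneg
  have hcd : c * (2 * p.z * q.z) = ‖p.x - q.x‖ ^ 2 + p.z ^ 2 + q.z ^ 2 := by
    rw [hc, cosh_dist, div_mul_cancel₀ _ (by positivity)]
  rw [norm_sub_sq_real] at hcd
  have hrx : ‖r.x‖ ^ 2 = a ^ 2 * ‖p.x‖ ^ 2 + 2 * (a * (b * inner ℝ p.x q.x))
      + b ^ 2 * ‖q.x‖ ^ 2 := by
    rw [hx, norm_add_sq_real, norm_smul, norm_smul, inner_smul_left, inner_smul_right, mul_pow,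
      mul_pow]
    simp
  set A := a * p.z with hA
  set B := b * q.z with hB
  have hA0 : 0 ≤ A := by positivity
  have hB0 : 0 ≤ B := by positivity
  obtain rfl : a = 1 - b := by linarith
  have hz : r.z ^ 2 = A ^ 2 + B ^ 2 + 2 * A * B * c := by
    linear_combination hw - hrx - b * (1 - b) * hcd
  have c1 : Real.cosh (dist p r) = (A + B * c) / r.z := by
    rw [cosh_dist, div_eq_div_iff (by positivity) (by positivity)]
    have : ‖p.x - r.x‖ ^ 2 = b ^ 2 * (‖p.x‖ ^ 2 - 2 * inner ℝ p.x q.x + ‖q.x‖ ^ 2) := by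
      rw [← norm_sub_sq_real, hx]
      have : p.x - ((1 - b) • p.x + b • q.x) = b • (p.x - q.x) := by module
      rw [this, norm_smul, mul_pow, Real.norm_eq_abs, sq_abs]
    rw [this]
    linear_combination r.z * hz - b ^ 2 * r.z * hcd
  have c2 : Real.cosh (dist r q) = (B + A * c) / r.z := by
    rw [cosh_dist, div_eq_div_iff (by positivity) (by positivity)]
    have : ‖r.x - q.x‖ ^ 2 = (1 - b) ^ 2 * (‖p.x‖ ^ 2 - 2 * inner ℝ p.x q.x + ‖q.x‖ ^ 2) := by
      rw [← norm_sub_sq_real, hx]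
      have : ((1 - b) • p.x + b • q.x) - q.x = (1 - b) • (p.x - q.x) := by module
      rw [this, norm_smul, mul_pow, Real.norm_eq_abs, sq_abs]
    rw [this]
    linear_combination r.z * hz - (1 - b) ^ 2 * r.z * hcd
  have s1 : Real.sinh (dist p r) = B * s / r.z := by
    rw [← sq_eq_sq₀ (Real.sinh_nonneg_iff.2 dist_nonneg) (by positivity), Real.sinh_sq, c1]
    field_simp
    linear_combination B ^ 2 * hcs - hz
  have s2 : Real.sinh (dist r q) = A * s / r.z := by
    rw [← sq_eq_sq₀ (Real.sinh_nonneg_iff.2 dist_nonneg) (by positivity), Real.sinh_sq, c2]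
    field_simp
    linear_combination A ^ 2 * hcs - hz
  symm
  refine dist_eq_of_cosh (by positivity) ?_
  rw [Real.cosh_add, c1, c2, s1, s2, ← hc]
  field_simp
  linear_combination c * hz + A * B * hcs

end HypSpace

theorem IsHypConvex.convex_image_klein {K : Set (HypSpace m)} (hK : IsHypConvex K) :
    Convex ℝ (klein '' K) := by
  rintro _ ⟨p, hp, rfl⟩ _ ⟨q, hq, rfl⟩ a b ha hb hab
  have hΩ : ‖(a • klein p + b • klein q).1‖ ^ 2 < (a • klein p + b • klein q).2 := by
    have hp := p.z_pos
    have hq := q.z_pos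
    have hconv := (convexOn_norm (E := EuclideanSpace ℝ (Fin m)) convex_univ).pow (fun x _ => norm_nonneg x) 2
    have h1 := hconv.2 (Set.mem_univ p.x) (Set.mem_univ q.x) ha hb hab
    simp only [Pi.pow_apply, smul_eq_mul] at h1
    simp only [klein, Prod.smul_mk, Prod.mk_add_mk, smul_eq_mul]
    refine h1.trans_lt ?_
    rcases ha.eq_or_lt with rfl | ha
    · obtain rfl : b = 1 := by linarith
      nlinarith
    · nlinarith [mul_pos ha (pow_pos hp 2), mul_nonneg hb (pow_pos hq 2).le]
  have hk := klein_kleinInv hΩ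
  exact ⟨_, hK p hp q hq _ (dist_add_dist_of_klein_mem_segment ha hb hab hk), hk⟩

/-! ### Isometries -/

namespace HypSpace

/-- An isometry that is twice continuously differentiable in horospherical coordinates, together
with its inverse. (Every isometry of hyperbolic space is, but only some explicit ones are
needed.) -/
structure IsSmoothIsometry (φ : HypSpace m ≃ᵢ HypSpace m) : Prop where
  contDiff : ContDiff ℝ 2 fun v : EuclideanSpace ℝ (Fin m) × ℝ => horoCoord (φ (horoPoint v.1 v.2))
  contDiff_symm :
    ContDiff ℝ 2 fun v : EuclideanSpace ℝ (Fin m) × ℝ => horoCoord (φ.symm (horoPoint v.1 v.2))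

theorem isSmoothIsometry_refl : IsSmoothIsometry (IsometryEquiv.refl (HypSpace m)) := by
  have h : ContDiff ℝ 2 fun v : EuclideanSpace ℝ (Fin m) × ℝ => horoCoord (horoPoint v.1 v.2) := by
    simp only [horoCoord_horoPoint]
    exact contDiff_id
  exact ⟨h, h⟩

theorem IsSmoothIsometry.symm {φ : HypSpace m ≃ᵢ HypSpace m} (h : IsSmoothIsometry φ) :
    IsSmoothIsometry φ.symm :=
  ⟨h.contDiff_symm, h.contDiff⟩

theorem IsSmoothIsometry.trans {φ ψ : HypSpace m ≃ᵢ HypSpace m} (h : IsSmoothIsometry φ)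
    (h' : IsSmoothIsometry ψ) : IsSmoothIsometry (φ.trans ψ) := by
  constructor
  · have := h'.contDiff.comp h.contDiff
    simp only [Function.comp_def, horoPoint_horoCoord] at this
    exact this
  · have := h.contDiff_symm.comp h'.contDiff_symm
    simp only [Function.comp_def, horoPoint_horoCoord] at this
    exact this

theorem isometry_of_cosh {φ : HypSpace m → HypSpace m}
    (h : ∀ p q, Real.cosh (dist (φ p) (φ q)) = Real.cosh (dist p q)) : Isometry φ :=
  Isometry.of_dist_eq fun p q => dist_eq_of_cosh dist_nonneg (h p q)

/-- The similarity `(x, z) ↦ (eˢ (x - a), eˢ z)`. -/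
def similarityMap (a : EuclideanSpace ℝ (Fin m)) (s : ℝ) (p : HypSpace m) : HypSpace m :=
  ⟨Real.exp s • (p.x - a), Real.exp s * p.z, mul_pos (Real.exp_pos _) p.z_pos⟩

theorem isometry_similarityMap (a : EuclideanSpace ℝ (Fin m)) (s : ℝ) :
    Isometry (similarityMap a s) := by
  refine isometry_of_cosh fun p q => ?_
  have hp := p.z_pos
  have hq := q.z_pos
  have hs := Real.exp_pos s
  rw [cosh_dist, cosh_dist]
  simp only [similarityMap, ← smul_sub, sub_sub_sub_cancel_right, norm_smul, mul_pow,
    Real.norm_eq_abs, sq_abs]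
  field_simp

theorem similarityMap_neg (a : EuclideanSpace ℝ (Fin m)) (s : ℝ) (p : HypSpace m) :
    similarityMap (-(Real.exp s • a)) (-s) (similarityMap a s p) = p := by
  ext1
  · simp only [similarityMap]
    rw [sub_neg_eq_add, ← smul_add, sub_add_cancel, smul_smul, ← Real.exp_add, neg_add_cancel,
      Real.exp_zero, one_smul]
  · simp only [similarityMap]
    rw [← mul_assoc, ← Real.exp_add, neg_add_cancel, Real.exp_zero, one_mul]

theorem contDiff_similarityMap (a : EuclideanSpace ℝ (Fin m)) (s : ℝ) :
    ContDiff ℝ 2 fun v : EuclideanSpace ℝ (Fin m) × ℝ =>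
      horoCoord (similarityMap a s (horoPoint v.1 v.2)) := by
  have h : (fun v : EuclideanSpace ℝ (Fin m) × ℝ =>
      horoCoord (similarityMap a s (horoPoint v.1 v.2))) =
      fun v => (Real.exp s • (v.1 - a), v.2 - s) := by
    ext1 v
    simp only [horoCoord, similarityMap, horoPoint_x, horoPoint_z, ← Real.exp_add, Real.log_exp]
    congr 1
    ring
  rw [h]
  fun_prop

/-- The similarity `(x, z) ↦ (eˢ (x - a), eˢ z)` as an isometry. -/
def similarity (a : EuclideanSpace ℝ (Fin m)) (s : ℝ) : HypSpace m ≃ᵢ HypSpace m :=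
  IsometryEquiv.mk' (similarityMap a s) (similarityMap (-(Real.exp s • a)) (-s)) (fun p => by
    have := similarityMap_neg (-(Real.exp s • a)) (-s) p
    rw [smul_neg, neg_neg, neg_neg, smul_smul, ← Real.exp_add, neg_add_cancel, Real.exp_zero,
      one_smul] at this
    exact this) (isometry_similarityMap a s)

theorem isSmoothIsometry_similarity (a : EuclideanSpace ℝ (Fin m)) (s : ℝ) :
    IsSmoothIsometry (similarity a s) :=
  ⟨contDiff_similarityMap _ _, contDiff_similarityMap _ _⟩

/-- The inversion in the sphere with centre `(ξ, 0)` that passes through `(0, 1)`. -/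
def inversionMap (ξ : EuclideanSpace ℝ (Fin m)) (p : HypSpace m) : HypSpace m :=
  ⟨ξ + ((‖ξ‖ ^ 2 + 1) / (‖p.x - ξ‖ ^ 2 + p.z ^ 2)) • (p.x - ξ),
    (‖ξ‖ ^ 2 + 1) / (‖p.x - ξ‖ ^ 2 + p.z ^ 2) * p.z, by
      have := p.z_pos
      positivity⟩

theorem inversionMap_inversionMap (ξ : EuclideanSpace ℝ (Fin m)) (p : HypSpace m) :
    inversionMap ξ (inversionMap ξ p) = p := by
  have hz := p.z_pos
  have hN : 0 < ‖p.x - ξ‖ ^ 2 + p.z ^ 2 := by positivity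
  have hR : 0 < ‖ξ‖ ^ 2 + 1 := by positivity
  have key : (‖ξ‖ ^ 2 + 1) / (‖(inversionMap ξ p).x - ξ‖ ^ 2 + (inversionMap ξ p).z ^ 2) *
      ((‖ξ‖ ^ 2 + 1) / (‖p.x - ξ‖ ^ 2 + p.z ^ 2)) = 1 := by
    simp only [inversionMap, add_sub_cancel_left, norm_smul, mul_pow, Real.norm_eq_abs, sq_abs]
    rw [← mul_add]
    field_simp
  ext1
  · rw [inversionMap]
    simp only
    have : (inversionMap ξ p).x - ξ =
        ((‖ξ‖ ^ 2 + 1) / (‖p.x - ξ‖ ^ 2 + p.z ^ 2)) • (p.x - ξ) := by simp [inversionMap]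
    nth_rewrite 2 [this]
    rw [smul_smul, key, one_smul, add_sub_cancel]
  · rw [inversionMap]
    simp only
    have : (inversionMap ξ p).z =
        ((‖ξ‖ ^ 2 + 1) / (‖p.x - ξ‖ ^ 2 + p.z ^ 2)) * p.z := by simp [inversionMap]
    nth_rewrite 2 [this]
    rw [← mul_assoc, key, one_mul]

theorem isometry_inversionMap (ξ : EuclideanSpace ℝ (Fin m)) : Isometry (inversionMap ξ) := by
  refine isometry_of_cosh fun p q => ?_
  have hp := p.z_pos
  have hq := q.z_pos
  rw [cosh_dist, cosh_dist]
  simp only [inversionMap, add_sub_add_left_eq_sub]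
  rw [← sub_sub_sub_cancel_right p.x q.x ξ]
  generalize p.x - ξ = a
  generalize q.x - ξ = b
  rw [norm_sub_sq_real, norm_sub_sq_real, norm_smul, norm_smul, inner_smul_left, inner_smul_right,
    mul_pow, mul_pow, Real.norm_eq_abs, Real.norm_eq_abs, sq_abs, sq_abs]
  have hR : 0 < ‖ξ‖ ^ 2 + 1 := by positivity
  generalize ‖ξ‖ ^ 2 + 1 = R at hR
  have h1 : 0 < ‖a‖ ^ 2 + p.z ^ 2 := by positivity
  have h2 : 0 < ‖b‖ ^ 2 + q.z ^ 2 := by positivity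
  generalize p.z = s at *
  generalize q.z = t at *
  generalize inner ℝ a b = g
  generalize ‖a‖ ^ 2 = A at *
  generalize ‖b‖ ^ 2 = B at *
  simp only [conj_trivial]
  field_simp
  ring

/-- The inversion in the sphere with centre `(ξ, 0)` that passes through `(0, 1)`, as an
isometry. -/
def inversion (ξ : EuclideanSpace ℝ (Fin m)) : HypSpace m ≃ᵢ HypSpace m :=
  IsometryEquiv.mk' (inversionMap ξ) (inversionMap ξ) (inversionMap_inversionMap ξ)
    (isometry_inversionMap ξ)

theorem isSmoothIsometry_inversion (ξ : EuclideanSpace ℝ (Fin m)) :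
    IsSmoothIsometry (inversion ξ) := by
  have hN : ∀ v : EuclideanSpace ℝ (Fin m) × ℝ, ‖v.1 - ξ‖ ^ 2 + Real.exp (-v.2) ^ 2 ≠ 0 :=
    fun v => by positivity
  have h : ContDiff ℝ 2 fun v : EuclideanSpace ℝ (Fin m) × ℝ =>
      horoCoord (inversionMap ξ (horoPoint v.1 v.2)) := by
    have hpos : ∀ v : EuclideanSpace ℝ (Fin m) × ℝ,
      (‖ξ‖ ^ 2 + 1) / (‖v.1 - ξ‖ ^ 2 + Real.exp (-v.2) ^ 2) * Real.exp (-v.2) ≠ 0 :=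
      fun v => by positivity
    have hNs : ContDiff ℝ 2 fun v : EuclideanSpace ℝ (Fin m) × ℝ =>
        ‖v.1 - ξ‖ ^ 2 + Real.exp (-v.2) ^ 2 :=
      ((contDiff_fst.sub contDiff_const).norm_sq ℝ).add (by fun_prop)
    have hq := (contDiff_const (c := ‖ξ‖ ^ 2 + 1)).div hNs hN
    refine ContDiff.prodMk ?_ ?_
    · simp only [inversionMap, horoPoint_x, horoPoint_z]
      exact contDiff_const.add (hq.smul (contDiff_fst.sub contDiff_const))
    · simp only [inversionMap, horoPoint_x, horoPoint_z]
      exact ((hq.mul (by fun_prop)).log hpos).neg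
  exact ⟨h, h⟩

theorem inversion_base (ξ : EuclideanSpace ℝ (Fin m)) :
    inversion ξ (horoPoint 0 0) = horoPoint 0 0 := by
  have h : inversion ξ (horoPoint 0 0) = inversionMap ξ (horoPoint 0 0) := rfl
  have h1 : ‖ξ‖ ^ 2 + 1 ≠ 0 := by positivity
  rw [h]
  ext1 <;> simp [inversionMap, div_self h1]

/-- The stabilizer of `(0, 1)` rotates any other point to the upper vertical half-axis. -/
theorem exists_isSmoothIsometry_rotate (o : HypSpace m) (ho : o ≠ horoPoint 0 0) :
    ∃ φ : HypSpace m ≃ᵢ HypSpace m, IsSmoothIsometry φ ∧ φ (horoPoint 0 0) = horoPoint 0 0 ∧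
      φ o = horoPoint 0 (-dist o (horoPoint 0 0)) := by
  have hz := o.z_pos
  have hd := dist_pos.2 ho
  have hc := cosh_dist o (horoPoint 0 0)
  set s := Real.exp (dist o (horoPoint 0 0)) with hs
  have hs1 : 1 < s := by rw [hs]; exact Real.one_lt_exp_iff.2 hd
  rw [Real.cosh_eq, Real.exp_neg, ← hs] at hc
  simp only [horoPoint_x, horoPoint_z, sub_zero, neg_zero, Real.exp_zero, one_pow, mul_one] at hc
  have hs0 : 0 < s := by linarith
  have hx : ‖o.x‖ ^ 2 * s = (s - o.z) * (o.z * s - 1) := by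
    field_simp at hc
    linear_combination -hc
  by_cases hzs : o.z = s
  · refine ⟨IsometryEquiv.refl _, isSmoothIsometry_refl, rfl, ?_⟩
    rw [hzs, sub_self, zero_mul, mul_eq_zero, or_iff_left hs0.ne', sq_eq_zero_iff,
      norm_eq_zero] at hx
    change o = _
    ext1
    · simpa using hx
    · simp [hzs, hs]
  · have hsz : s - o.z ≠ 0 := sub_ne_zero.2 (Ne.symm hzs)
    -- the centre is where the line through `o` and its target `(0, s)` meets the boundary
    refine ⟨inversion ((s / (s - o.z)) • o.x), isSmoothIsometry_inversion _, inversion_base _, ?_⟩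
    have h : inversion ((s / (s - o.z)) • o.x) o = inversionMap ((s / (s - o.z)) • o.x) o := rfl
    have hxξ : o.x - (s / (s - o.z)) • o.x = (-(o.z / (s - o.z))) • o.x := by
      have : -(o.z / (s - o.z)) = 1 - s / (s - o.z) := by field_simp; ring
      rw [this, sub_smul, one_smul]
    have hratio : (‖(s / (s - o.z)) • o.x‖ ^ 2 + 1) /
        (‖o.x - (s / (s - o.z)) • o.x‖ ^ 2 + o.z ^ 2) = s / o.z := by
      rw [hxξ, norm_smul, norm_smul, mul_pow, mul_pow, Real.norm_eq_abs, Real.norm_eq_abs, sq_abs,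
        sq_abs, neg_sq, div_pow, div_pow, div_eq_div_iff (by positivity) hz.ne']
      field_simp
      linear_combination (s - o.z) * hx
    rw [h, inversionMap]
    simp only [hratio]
    ext1
    · simp only [horoPoint_x]
      rw [hxξ, smul_smul, ← add_smul]
      have : s / (s - o.z) + s / o.z * -(o.z / (s - o.z)) = 0 := by field_simp; ring
      rw [this, zero_smul]
    · simp only [horoPoint_z, neg_neg]
      rw [div_mul_cancel₀ _ hz.ne']

theorem exists_isSmoothIsometry_base (q : HypSpace m) :
    ∃ φ : HypSpace m ≃ᵢ HypSpace m, IsSmoothIsometry φ ∧ φ q = horoPoint 0 0 := by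
  refine ⟨similarity q.x (-Real.log q.z), isSmoothIsometry_similarity _ _, ?_⟩
  change similarityMap q.x (-Real.log q.z) q = _
  ext1
  · simp [similarityMap]
  · simp [similarityMap, Real.exp_neg, Real.exp_log q.z_pos, q.z_pos.ne']

/-- Any two points can be moved to the upper vertical half-axis, the first one to `(0, 1)`. -/
theorem exists_isSmoothIsometry_axis {q o : HypSpace m} (h : o ≠ q) :
    ∃ φ : HypSpace m ≃ᵢ HypSpace m, IsSmoothIsometry φ ∧ φ q = horoPoint 0 0 ∧
      φ o = horoPoint 0 (-dist o q) := by
  obtain ⟨φ, hφ, hq⟩ := exists_isSmoothIsometry_base q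
  obtain ⟨ψ, hψ, h0, ho⟩ := exists_isSmoothIsometry_rotate (φ o)
    (by rw [← hq]; exact φ.injective.ne h)
  refine ⟨φ.trans ψ, hφ.trans hψ, ?_, ?_⟩
  · rw [IsometryEquiv.trans_apply, hq, h0]
  · rw [IsometryEquiv.trans_apply, ho, ← hq, φ.dist_eq]

end HypSpace

/-! ### Support hyperplanes -/

namespace HypSpace

/-- In the projective model a bisector is an affine hyperplane. -/
theorem dist_le_dist_iff_klein (p a b : HypSpace m) :
    dist p a ≤ dist p b ↔
      0 ≤ (a.z - b.z) * (klein p).2 + 2 * inner ℝ (b.z • a.x - a.z • b.x) (klein p).1 +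
        (a.z * (klein b).2 - b.z * (klein a).2) := by
  have hp := p.z_pos
  have ha := a.z_pos
  have hb := b.z_pos
  rw [dist_le_dist_iff_cosh, cosh_dist, cosh_dist, div_le_div_iff₀ (by positivity) (by positivity)]
  simp only [klein, norm_sub_sq_real, inner_sub_left, inner_smul_left, conj_trivial]
  rw [real_inner_comm p.x a.x, real_inner_comm p.x b.x]
  rw [← mul_le_mul_iff_right₀ (show 0 < 2 * p.z by positivity), ← sub_nonneg]
  conv_rhs => rw [← mul_nonneg_iff_of_pos_left (show 0 < (2 * p.z) * (2 * p.z) by positivity)]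
  ring_nf

/-- The reflection of a point in `(0, 1)`. -/
def pointReflection (a : HypSpace m) : HypSpace m :=
  ⟨-((‖a.x‖ ^ 2 + a.z ^ 2)⁻¹ • a.x), (‖a.x‖ ^ 2 + a.z ^ 2)⁻¹ * a.z, by
    have := a.z_pos
    positivity⟩

theorem dist_le_dist_pointReflection_iff (p a : HypSpace m) :
    dist p a ≤ dist p (pointReflection a) ↔
      0 ≤ ((klein a).2 - 1) * ((klein p).2 - 1) + 2 * inner ℝ ((2 : ℝ) • a.x) (klein p).1 := by
  have ha := a.z_pos
  rw [dist_le_dist_iff_klein]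
  have hw : 0 < ‖a.x‖ ^ 2 + a.z ^ 2 := by positivity
  simp only [klein, pointReflection, norm_neg, norm_smul, mul_pow, inner_sub_left, inner_smul_left,
    inner_neg_left, conj_trivial, Real.norm_eq_abs, sq_abs, ← mul_add, inv_pow, smul_neg]
  conv_rhs => rw [← mul_nonneg_iff_of_pos_left
    (show 0 < a.z / (‖a.x‖ ^ 2 + a.z ^ 2) by positivity)]
  refine iff_of_eq (congrArg _ ?_)
  field_simp
  ring

theorem dist_pointReflection_le_dist_iff (p a : HypSpace m) :
    dist p (pointReflection a) ≤ dist p a ↔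
      ((klein a).2 - 1) * ((klein p).2 - 1) + 2 * inner ℝ ((2 : ℝ) • a.x) (klein p).1 ≤ 0 := by
  have ha := a.z_pos
  rw [dist_le_dist_iff_klein]
  have hw : 0 < ‖a.x‖ ^ 2 + a.z ^ 2 := by positivity
  simp only [klein, pointReflection, norm_neg, norm_smul, mul_pow, inner_sub_left, inner_smul_left,
    inner_neg_left, conj_trivial, Real.norm_eq_abs, sq_abs, ← mul_add, inv_pow, smul_neg]
  conv_rhs => rw [← neg_nonneg, ← mul_nonneg_iff_of_pos_left
    (show 0 < a.z / (‖a.x‖ ^ 2 + a.z ^ 2) by positivity)]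
  refine iff_of_eq (congrArg _ ?_)
  field_simp
  ring

theorem dist_pointReflection_base (a : HypSpace m) :
    dist (pointReflection a) (horoPoint 0 0) = dist a (horoPoint 0 0) := by
  refine dist_eq_of_cosh dist_nonneg ?_
  have ha := a.z_pos
  have hw : 0 < ‖a.x‖ ^ 2 + a.z ^ 2 := by positivity
  rw [cosh_dist, cosh_dist]
  simp only [pointReflection, horoPoint_x, horoPoint_z, sub_zero, norm_neg, norm_smul, mul_pow,
    Real.norm_eq_abs, sq_abs, ← mul_add, neg_zero, Real.exp_zero]
  field_simp
  ring

theorem dist_pointReflection_self (a : HypSpace m) :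
    dist (pointReflection a) a = 2 * dist a (horoPoint 0 0) := by
  refine dist_eq_of_cosh (mul_nonneg zero_le_two dist_nonneg) ?_
  have ha := a.z_pos
  have hw : 0 < ‖a.x‖ ^ 2 + a.z ^ 2 := by positivity
  have hx : -((‖a.x‖ ^ 2 + a.z ^ 2)⁻¹ • a.x) - a.x =
      (-((‖a.x‖ ^ 2 + a.z ^ 2)⁻¹ + 1)) • a.x := by module
  rw [Real.cosh_two_mul, Real.sinh_sq, cosh_dist, cosh_dist]
  simp only [pointReflection, hx, horoPoint_x, horoPoint_z, sub_zero, norm_smul, mul_pow,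
    Real.norm_eq_abs, sq_abs, neg_sq, neg_zero, Real.exp_zero]
  field_simp
  ring

/-- Uniqueness of the continuation of the vertical geodesic through `(0, 1)`. -/
theorem eq_horoPoint_of_dist {p : HypSpace m} {d : ℝ} (hd : 0 < d)
    (h1 : dist p (horoPoint 0 0) = d) (h2 : dist p (horoPoint 0 (-d)) = 2 * d) :
    p = horoPoint 0 d := by
  have hz := p.z_pos
  have e1 := cosh_dist p (horoPoint 0 0)
  have e2 := cosh_dist p (horoPoint 0 (-d))
  rw [h1] at e1
  rw [h2, Real.cosh_two_mul, Real.sinh_sq] at e2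
  simp only [horoPoint_x, horoPoint_z, sub_zero, neg_neg, neg_zero, Real.exp_zero] at e1 e2
  rw [Real.cosh_eq, Real.exp_neg] at e1 e2
  have hs : 1 < Real.exp d := Real.one_lt_exp_iff.2 hd
  have hpz : Real.exp (-d) = (Real.exp d)⁻¹ := Real.exp_neg d
  set s := Real.exp d with hsdef
  have hs0 : 0 < s := by linarith
  field_simp at e1 e2
  have hs2 : s ^ 2 - 1 ≠ 0 := by nlinarith
  have e3 : p.z * s = 1 := by
    have : (s ^ 2 - 1) * (p.z * s - 1) = 0 := by
      have h3 : s * ((s ^ 2 - 1) * (p.z * s - 1)) = 0 := by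
        linear_combination e2 / 2 - e1
      exact (mul_eq_zero.1 h3).resolve_left hs0.ne'
    linarith [(mul_eq_zero.1 this).resolve_left hs2]
  have e4 : p.z = s⁻¹ := eq_inv_of_mul_eq_one_left e3
  ext1
  · rw [e4] at e1
    field_simp at e1
    have : ‖p.x‖ ^ 2 = 0 := by
      have h3 : s ^ 2 * ‖p.x‖ ^ 2 = 0 := by linear_combination -e1
      exact (mul_eq_zero.1 h3).resolve_left (by positivity)
    simpa using this
  · rw [horoPoint_z, hpz, e4]

/-- Every hyperplane through `(0, 1)` is the bisector of a point and its reflection in `(0, 1)`. -/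
theorem exists_bisector_base {α : ℝ} {β : EuclideanSpace ℝ (Fin m)} (h : α ≠ 0 ∨ β ≠ 0) :
    ∃ a : HypSpace m, a ≠ horoPoint 0 0 ∧
      (∀ p, dist p a ≤ dist p (pointReflection a) ↔
        0 ≤ α * ((klein p).2 - 1) + inner ℝ β (klein p).1) ∧
      ∀ p, dist p (pointReflection a) ≤ dist p a ↔
        α * ((klein p).2 - 1) + inner ℝ β (klein p).1 ≤ 0 := by
  -- the point in the direction of the normal at a small distance `≈ κ`
  set κ : ℝ := 1 / (1 + |α| + ‖β‖) with hκ
  have hκ0 : 0 < κ := by positivity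
  have hκ1 : κ * (1 + |α| + ‖β‖) = 1 := by rw [hκ, one_div, inv_mul_cancel₀ (by positivity)]
  have hpos : 0 < 1 + κ * α - ‖(κ / 4) • β‖ ^ 2 := by
    rw [norm_smul, Real.norm_of_nonneg (by positivity)]
    have h1 : κ * -α ≤ κ * |α| := by gcongr; exact neg_le_abs α
    have h2 : κ * ‖β‖ ≤ 1 := by nlinarith [mul_nonneg hκ0.le (abs_nonneg α)]
    have h3 : 0 ≤ κ * ‖β‖ := by positivity
    nlinarith
  set a : HypSpace m := ⟨(κ / 4) • β, √(1 + κ * α - ‖(κ / 4) • β‖ ^ 2), Real.sqrt_pos.2 hpos⟩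
    with ha
  have haw : (klein a).2 = 1 + κ * α := by
    simp only [klein, ha, Real.sq_sqrt hpos.le]
    ring
  have key : ∀ p : HypSpace m, ((klein a).2 - 1) * ((klein p).2 - 1) +
      2 * inner ℝ ((2 : ℝ) • a.x) (klein p).1 =
      κ * (α * ((klein p).2 - 1) + inner ℝ β (klein p).1) := by
    intro p
    rw [haw]
    simp only [ha, inner_smul_left, conj_trivial]
    ring
  refine ⟨a, fun he => ?_, fun p => ?_, fun p => ?_⟩
  · have h1 : (klein a).2 = 1 := by rw [he]; simp [klein]
    have h2 : a.x = 0 := by rw [he, horoPoint_x]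
    rw [haw, add_eq_left, mul_eq_zero, or_iff_right hκ0.ne'] at h1
    rw [ha] at h2
    simp only [smul_eq_zero] at h2
    rcases h with h | h
    · exact h h1
    · exact h (h2.resolve_left (by positivity))
  · rw [dist_le_dist_pointReflection_iff, key, mul_nonneg_iff_of_pos_left hκ0]
  · rw [dist_pointReflection_le_dist_iff, key, ← neg_nonneg, ← mul_neg,
      mul_nonneg_iff_of_pos_left hκ0, neg_nonneg]

theorem klein_similarity_base (q p : HypSpace m) :
    klein (similarity q.x (-Real.log q.z) p) = (q.z⁻¹ • ((klein p).1 - q.x),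
      1 + (q.z⁻¹) ^ 2 * ((klein p).2 - (klein q).2 - 2 * inner ℝ q.x ((klein p).1 - q.x))) := by
  change klein (similarityMap q.x (-Real.log q.z) p) = _
  have hq := q.z_pos
  simp only [klein, similarityMap, Real.exp_neg, Real.exp_log hq, norm_smul, mul_pow,
    norm_sub_sq_real, inner_sub_right, real_inner_self_eq_norm_sq, Real.norm_eq_abs, sq_abs]
  rw [real_inner_comm p.x q.x]
  congr 1
  field_simp
  ring

theorem similarity_base (q : HypSpace m) :
    similarity q.x (-Real.log q.z) q = horoPoint 0 0 := by
  apply klein_injective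
  rw [klein_similarity_base]
  simp [klein]

theorem strongDual_prod_apply (ℓ : EuclideanSpace ℝ (Fin m) × ℝ →L[ℝ] ℝ)
    (v : EuclideanSpace ℝ (Fin m) × ℝ) :
    ℓ v = ℓ (0, 1) * v.2 + inner ℝ ((InnerProductSpace.toDual ℝ _).symm
      (ℓ.comp (ContinuousLinearMap.inl ℝ _ ℝ))) v.1 := by
  rw [InnerProductSpace.toDual_symm_apply]
  have : v = (v.1, (0 : ℝ)) + v.2 • ((0 : EuclideanSpace ℝ (Fin m)), (1 : ℝ)) := by
    ext1 <;> simp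
  conv_lhs => rw [this, map_add, map_smul]
  simp
  ring

/-- Affine hyperplanes of the projective model are bisectors. -/
theorem exists_bisector (q : HypSpace m) {ℓ : EuclideanSpace ℝ (Fin m) × ℝ →L[ℝ] ℝ}
    (hℓ : ℓ ≠ 0) :
    ∃ a b : HypSpace m, a ≠ b ∧
      (∀ p, dist p a ≤ dist p b ↔ ℓ (klein q) ≤ ℓ (klein p)) ∧
      ∀ p, dist p b ≤ dist p a ↔ ℓ (klein p) ≤ ℓ (klein q) := by
  have hq := q.z_pos
  set α := ℓ (0, 1) with hα
  set β := (InnerProductSpace.toDual ℝ _).symm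
    (ℓ.comp (ContinuousLinearMap.inl ℝ (EuclideanSpace ℝ (Fin m)) ℝ)) with hβ
  have hsplit : ∀ v, ℓ v = α * v.2 + inner ℝ β v.1 := strongDual_prod_apply ℓ
  set φ := similarity q.x (-Real.log q.z)
  have hne : q.z * α ≠ 0 ∨ β + (2 * α) • q.x ≠ 0 := by
    by_contra! h
    have h1 : α = 0 := (mul_eq_zero.1 h.1).resolve_left hq.ne'
    have h2 : β = 0 := by simpa [h1] using h.2
    exact hℓ (ContinuousLinearMap.ext fun v => by simp [hsplit, h1, h2])
  obtain ⟨a, ha, h1, h2⟩ := exists_bisector_base hne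
  have key : ∀ p, q.z * α * ((klein (φ p)).2 - 1) +
      inner ℝ (β + (2 * α) • q.x) (klein (φ p)).1 = q.z⁻¹ * (ℓ (klein p) - ℓ (klein q)) := by
    intro p
    rw [klein_similarity_base, hsplit, hsplit]
    simp only [inner_add_left, inner_smul_right, inner_smul_left, conj_trivial, inner_sub_right]
    have : (klein q).1 = q.x := rfl
    rw [this]
    field_simp
    ring
  have hq' : 0 < q.z⁻¹ := inv_pos.2 hq
  refine ⟨φ.symm a, φ.symm (pointReflection a), ?_, fun p => ?_, fun p => ?_⟩
  · refine φ.symm.injective.ne fun h => ha ?_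
    have h3 := dist_pointReflection_self a
    rw [← h, dist_self] at h3
    exact dist_eq_zero.1 (by linarith)
  · rw [← φ.dist_eq p, ← φ.dist_eq p, φ.apply_symm_apply, φ.apply_symm_apply, h1, key,
      mul_nonneg_iff_of_pos_left hq', sub_nonneg]
  · rw [← φ.dist_eq p, ← φ.dist_eq p, φ.apply_symm_apply, φ.apply_symm_apply, h2, key,
      ← neg_nonneg, ← mul_neg, mul_nonneg_iff_of_pos_left hq', neg_sub, sub_nonneg]

/-- Bisectors are affine hyperplanes of the projective model. -/
theorem exists_strongDual_of_bisector {a b q : HypSpace m} (hab : a ≠ b)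
    (hq : dist q a = dist q b) :
    ∃ ℓ : EuclideanSpace ℝ (Fin m) × ℝ →L[ℝ] ℝ, ℓ ≠ 0 ∧
      (∀ p, dist p a ≤ dist p b ↔ ℓ (klein q) ≤ ℓ (klein p)) ∧
      ∀ p, dist p b ≤ dist p a ↔ ℓ (klein p) ≤ ℓ (klein q) := by
  set ℓ : EuclideanSpace ℝ (Fin m) × ℝ →L[ℝ] ℝ :=
    (a.z - b.z) • ContinuousLinearMap.snd ℝ _ ℝ +
      (2 : ℝ) • (innerSL ℝ (b.z • a.x - a.z • b.x)).comp (ContinuousLinearMap.fst ℝ _ ℝ) with hℓ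
  have hap : ∀ v, ℓ v = (a.z - b.z) * v.2 + 2 * inner ℝ (b.z • a.x - a.z • b.x) v.1 := by
    intro v
    simp [hℓ, inner_sub_left, inner_smul_left]
  have h1 := (dist_le_dist_iff_klein q a b).1 hq.le
  have h2 := (dist_le_dist_iff_klein q b a).1 hq.ge
  have hsw : ∀ v : EuclideanSpace ℝ (Fin m), inner ℝ (a.z • b.x - b.z • a.x) v =
      - inner ℝ (b.z • a.x - a.z • b.x) v := by
    intro v
    rw [← inner_neg_left, neg_sub]
  rw [hsw] at h2
  have h3 : a.z * (klein b).2 - b.z * (klein a).2 = -ℓ (klein q) := by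
    rw [hap]
    linarith
  refine ⟨ℓ, fun h0 => hab ?_, fun p => ?_, fun p => ?_⟩
  · have e1 : a.z - b.z = 0 := by
      have := congrArg (fun L => L (0, 1)) h0
      simpa [hap] using this
    have e2 : b.z • a.x - a.z • b.x = 0 := by
      have := congrArg (fun L => L (b.z • a.x - a.z • b.x, 0)) h0
      simpa [hap] using this
    have e3 : a.z = b.z := sub_eq_zero.1 e1
    rw [e3, ← smul_sub, smul_eq_zero, or_iff_right b.z_pos.ne', sub_eq_zero] at e2
    exact HypSpace.ext e2 e3
  · rw [dist_le_dist_iff_klein, h3, ← hap, ← sub_eq_add_neg, sub_nonneg]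
  · rw [dist_le_dist_iff_klein, hsw]
    have : b.z * (klein a).2 - a.z * (klein b).2 = ℓ (klein q) := by linarith
    rw [this]
    have h4 := hap (klein p)
    constructor <;> intro h <;> linarith

end HypSpace

theorem isSupportHyperplane_iff {K : Set (HypSpace m)} {q : HypSpace m} {P : Set (HypSpace m)} :
    IsSupportHyperplane K q P ↔ ∃ ℓ : EuclideanSpace ℝ (Fin m) × ℝ →L[ℝ] ℝ, ℓ ≠ 0 ∧
      P = {p | ℓ (klein p) = ℓ (klein q)} ∧ ∀ p ∈ K, ℓ (klein q) ≤ ℓ (klein p) := by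
  constructor
  · rintro ⟨hqP, a, b, hab, rfl, hK⟩
    obtain ⟨ℓ, h0, h1, h2⟩ := exists_strongDual_of_bisector hab hqP
    refine ⟨ℓ, h0, ?_, fun p hp => (h1 p).1 (hK hp)⟩
    ext p
    exact ⟨fun h => le_antisymm ((h2 p).1 (ge_of_eq h)) ((h1 p).1 (le_of_eq h)),
      fun h => le_antisymm ((h1 p).2 (ge_of_eq h)) ((h2 p).2 (le_of_eq h))⟩
  · rintro ⟨ℓ, h0, rfl, hK⟩
    obtain ⟨a, b, hab, h1, h2⟩ := exists_bisector q h0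
    refine ⟨rfl, a, b, hab, ?_, fun p hp => (h1 p).2 (hK p hp)⟩
    ext p
    exact ⟨fun h => le_antisymm ((h1 p).2 (ge_of_eq h)) ((h2 p).2 (le_of_eq h)),
      fun h => le_antisymm ((h2 p).1 (ge_of_eq h)) ((h1 p).1 (le_of_eq h))⟩

theorem IsSupportHyperplane.image {K : Set (HypSpace m)} {q : HypSpace m} {P : Set (HypSpace m)}
    (h : IsSupportHyperplane K q P) (φ : HypSpace m ≃ᵢ HypSpace m) :
    IsSupportHyperplane (φ '' K) (φ q) (φ '' P) := by
  obtain ⟨hq, a, b, hab, rfl, hK⟩ := h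
  refine ⟨⟨q, hq, rfl⟩, φ a, φ b, φ.injective.ne hab, ?_, ?_⟩
  · ext p
    obtain ⟨p, rfl⟩ := φ.surjective p
    simp only [Set.mem_image, EmbeddingLike.apply_eq_iff_eq, exists_eq_right]
    rw [Set.mem_ofPred_eq, Set.mem_ofPred_eq, φ.dist_eq, φ.dist_eq]
  · rintro _ ⟨p, hp, rfl⟩
    rw [Set.mem_ofPred_eq, φ.dist_eq, φ.dist_eq]
    exact hK hp

theorem IsHypConvexBody.image {K : Set (HypSpace m)} (hK : IsHypConvexBody K)
    (φ : HypSpace m ≃ᵢ HypSpace m) : IsHypConvexBody (φ '' K) where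
  isCompact := hK.isCompact.image φ.continuous
  convex := by
    rintro _ ⟨p, hp, rfl⟩ _ ⟨q, hq, rfl⟩ r hr
    refine ⟨φ.symm r, hK.convex p hp q hq _ ?_, φ.apply_symm_apply r⟩
    rwa [← φ.dist_eq, ← φ.dist_eq (φ.symm r), ← φ.dist_eq p q, φ.apply_symm_apply]
  nonempty_interior := by
    have h : interior (φ '' K) = φ '' interior K := (φ.toHomeomorph.image_interior K).symm
    rw [h]
    exact hK.nonempty_interior.image _

theorem IsHypConvexBody.exists_isSupportHyperplane {K : Set (HypSpace m)} (hK : IsHypConvexBody K)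
    {q : HypSpace m} (hq : q ∈ frontier K) : ∃ P, IsSupportHyperplane K q P := by
  have hC := hK.convex.convex_image_klein
  obtain ⟨o, ho⟩ := hK.nonempty_interior
  have hint : (interior (klein '' K)).Nonempty := ⟨_, klein_mem_interior_image_iff.2 ho⟩
  obtain ⟨ℓ, hℓ⟩ := geometric_hahn_banach_point_open (x := klein q) hC.interior isOpen_interior
    (fun h => hq.2 (klein_mem_interior_image_iff.1 h))
  refine ⟨_, isSupportHyperplane_iff.2 ⟨ℓ, ?_, rfl, fun p hp => ?_⟩⟩
  · rintro rfl
    simpa using hℓ _ hint.choose_spec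
  · have h1 : klein p ∈ closure (interior (klein '' K)) := by
      rw [hC.closure_interior_eq_closure_of_nonempty_interior hint]
      exact subset_closure ⟨p, hp, rfl⟩
    have h2 : closure (interior (klein '' K)) ⊆ {v | ℓ (klein q) ≤ ℓ v} :=
      closure_minimal (fun v hv => (hℓ v hv).le) (isClosed_le continuous_const ℓ.continuous)
    exact h2 h1

/-- A chart that takes a given support hyperplane to the unit hemisphere, with the body outside. -/
theorem IsSupportHyperplane.exists_isSmoothIsometry {K : Set (HypSpace m)} {q : HypSpace m}
    {P : Set (HypSpace m)} (h : IsSupportHyperplane K q P) :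
    ∃ φ : HypSpace m ≃ᵢ HypSpace m, IsSmoothIsometry φ ∧ φ q = horoPoint 0 0 ∧
      φ '' P = {p | ‖p.x‖ ^ 2 + p.z ^ 2 = 1} ∧ ∀ p ∈ φ '' K, 1 ≤ ‖p.x‖ ^ 2 + p.z ^ 2 := by
  obtain ⟨φ, hφ, hφq⟩ := exists_isSmoothIsometry_base q
  have h' := h.image φ
  rw [hφq] at h'
  obtain ⟨ℓ, h0, hP, hK⟩ := isSupportHyperplane_iff.1 h'
  set α := ℓ (0, 1) with hα
  set β := (InnerProductSpace.toDual ℝ _).symm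
    (ℓ.comp (ContinuousLinearMap.inl ℝ (EuclideanSpace ℝ (Fin m)) ℝ)) with hβ
  have hsplit : ∀ v, ℓ v = α * v.2 + inner ℝ β v.1 := strongDual_prod_apply ℓ
  have hbase : ℓ (klein (horoPoint 0 0)) = α := by simp [hsplit, klein]
  have hne : α ≠ 0 ∨ β ≠ 0 := by
    by_contra! h
    exact h0 (ContinuousLinearMap.ext fun v => by simp [hsplit, h.1, h.2])
  obtain ⟨a, ha, h1, h2⟩ := exists_bisector_base hne
  have hd := dist_pos.2 ha
  obtain ⟨ψ, hψ, hψ0, hψa⟩ := exists_isSmoothIsometry_rotate a ha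
  set d := dist a (horoPoint 0 0) with hd'
  have hψb : ψ (pointReflection a) = horoPoint 0 d := by
    refine eq_horoPoint_of_dist hd ?_ ?_
    · rw [← hψ0, ψ.dist_eq, dist_pointReflection_base]
    · rw [← hψa, ψ.dist_eq, dist_pointReflection_self]
  have hs : Real.exp (-d) < Real.exp d := Real.exp_lt_exp.2 (by linarith)
  have hes : Real.exp d * Real.exp (-d) = 1 := by rw [← Real.exp_add, add_neg_cancel, Real.exp_zero]
  have k1 : ∀ p, dist p a ≤ dist p (pointReflection a) ↔
      1 ≤ ‖(ψ p).x‖ ^ 2 + (ψ p).z ^ 2 := by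
    intro p
    rw [← ψ.dist_eq, ← ψ.dist_eq p, hψa, hψb, dist_le_dist_iff_klein]
    simp only [klein, horoPoint_x, horoPoint_z, smul_zero, sub_self, inner_zero_left, norm_zero,
      neg_neg]
    have : (Real.exp d - Real.exp (-d)) * (‖(ψ p).x‖ ^ 2 + (ψ p).z ^ 2) + 2 * 0 +
        (Real.exp d * (0 ^ 2 + Real.exp (-d) ^ 2) - Real.exp (-d) * (0 ^ 2 + Real.exp d ^ 2)) =
        (Real.exp d - Real.exp (-d)) * (‖(ψ p).x‖ ^ 2 + (ψ p).z ^ 2 - 1) := by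
      linear_combination (Real.exp (-d) - Real.exp d) * hes
    rw [this, mul_nonneg_iff_of_pos_left (sub_pos.2 hs), sub_nonneg]
  have k2 : ∀ p, dist p (pointReflection a) ≤ dist p a ↔
      ‖(ψ p).x‖ ^ 2 + (ψ p).z ^ 2 ≤ 1 := by
    intro p
    rw [← ψ.dist_eq, ← ψ.dist_eq p, hψa, hψb, dist_le_dist_iff_klein]
    simp only [klein, horoPoint_x, horoPoint_z, smul_zero, sub_self, inner_zero_left, norm_zero,
      neg_neg]
    have : (Real.exp (-d) - Real.exp d) * (‖(ψ p).x‖ ^ 2 + (ψ p).z ^ 2) + 2 * 0 +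
        (Real.exp (-d) * (0 ^ 2 + Real.exp d ^ 2) - Real.exp d * (0 ^ 2 + Real.exp (-d) ^ 2)) =
        (Real.exp d - Real.exp (-d)) * (1 - (‖(ψ p).x‖ ^ 2 + (ψ p).z ^ 2)) := by
      linear_combination (Real.exp d - Real.exp (-d)) * hes
    rw [this, mul_nonneg_iff_of_pos_left (sub_pos.2 hs), sub_nonneg]
  refine ⟨φ.trans ψ, hφ.trans hψ, ?_, ?_, ?_⟩
  · rw [IsometryEquiv.trans_apply, hφq, hψ0]
  · have he : (φ.trans ψ) '' P = ψ '' (φ '' P) := (Set.image_image ψ φ P).symm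
    rw [he, hP]
    ext p
    obtain ⟨p, rfl⟩ := ψ.surjective p
    simp only [Set.mem_image, EmbeddingLike.apply_eq_iff_eq, exists_eq_right]
    rw [Set.mem_ofPred_eq, Set.mem_ofPred_eq, le_antisymm_iff, le_antisymm_iff, ← k1, ← k2, h1,
      h2, hbase, hsplit]
    constructor <;> rintro ⟨e1, e2⟩ <;> constructor <;> linarith
  · rintro _ ⟨p, hp, rfl⟩
    rw [IsometryEquiv.trans_apply, ← k1, h1]
    have := hK (φ p) ⟨p, hp, rfl⟩
    rw [hbase, hsplit] at this
    linarith

/-! ### Contact of second order -/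

section SecondOrder

open Filter Asymptotics

/-- Taylor's theorem of second order. -/
theorem ContDiffAt.isLittleO_taylor_two {V : Type*} [NormedAddCommGroup V] [NormedSpace ℝ V]
    {H : V → ℝ} {v₀ : V} (hH : ContDiffAt ℝ 2 H v₀) :
    (fun v => H v - (H v₀ + fderiv ℝ H v₀ (v - v₀) +
      (1 / 2) * fderiv ℝ (fderiv ℝ H) v₀ (v - v₀) (v - v₀))) =o[𝓝 v₀] fun v => ‖v - v₀‖ ^ 2 := by
  have hd : ∀ᶠ v in 𝓝 v₀, DifferentiableAt ℝ H v :=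
    (hH.eventually (by simp)).mono fun v hv => hv.differentiableAt (by simp)
  have hd2 : DifferentiableAt ℝ (fderiv ℝ H) v₀ :=
    (hH.fderiv_right (m := 1) (by norm_num [one_add_one_eq_two])).differentiableAt (by simp)
  refine IsLittleO.of_bound fun η hη => ?_
  obtain ⟨δ, hδ, hball⟩ := Metric.eventually_nhds_iff_ball.1
    (hd.and (hd2.hasFDerivAt.isLittleO.bound hη))
  refine Metric.eventually_nhds_iff_ball.2 ⟨δ, hδ, fun v hv => ?_⟩
  rw [mem_ball_iff_norm] at hv
  set h := v - v₀ with hh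
  set L := fderiv ℝ H v₀
  set D := fderiv ℝ (fderiv ℝ H) v₀
  have hseg : ∀ t ∈ Set.Icc (0 : ℝ) 1, v₀ + t • h ∈ Metric.ball v₀ δ := by
    rintro t ⟨ht0, ht1⟩
    rw [mem_ball_iff_norm, add_sub_cancel_left, norm_smul, Real.norm_of_nonneg ht0]
    nlinarith [norm_nonneg h]
  have hderiv : ∀ t ∈ Set.Icc (0 : ℝ) 1, HasDerivWithinAt
      (fun t : ℝ => H (v₀ + t • h) - (t * L h + t ^ 2 * (1 / 2 * D h h)))
      ((fderiv ℝ H (v₀ + t • h) - L - D (t • h)) h) (Set.Icc (0 : ℝ) 1) t := by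
    intro t ht
    have h1 : HasDerivAt (fun t : ℝ => v₀ + t • h) h t := by
      simpa using ((hasDerivAt_id t).smul_const h).const_add v₀
    have h2 := (hball _ (hseg t ht)).1.hasFDerivAt.comp_hasDerivAt t h1
    have h3 := h2.sub (((hasDerivAt_id t).mul_const (L h)).add
      ((hasDerivAt_pow 2 t).mul_const (1 / 2 * D h h)))
    refine (h3.congr_deriv ?_).hasDerivWithinAt
    simp
    ring
  have hmv := norm_image_sub_le_of_norm_deriv_le_segment_01' (C := η * ‖h‖ ^ 2) hderiv ?_
  · simp only [one_smul, zero_smul, add_zero, one_pow, one_mul, zero_mul, hh, add_sub_cancel] at hmv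
    rw [← hh] at hmv
    rw [Real.norm_of_nonneg (sq_nonneg ‖h‖)]
    refine le_trans (le_of_eq ?_) hmv
    congr 1
    norm_num
    ring
  · intro t ht
    have ht' : t ∈ Set.Icc (0 : ℝ) 1 := ⟨ht.1, ht.2.le⟩
    have h1 := (hball _ (hseg t ht')).2
    rw [add_sub_cancel_left] at h1
    refine (ContinuousLinearMap.le_opNorm _ _).trans ?_
    have h2 : ‖t • h‖ ≤ ‖h‖ := by
      rw [norm_smul, Real.norm_of_nonneg ht.1]
      nlinarith [norm_nonneg h, ht.2]
    calc _ ≤ η * ‖t • h‖ * ‖h‖ := by gcongr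
      _ ≤ η * ‖h‖ * ‖h‖ := by gcongr
      _ = _ := by ring

/-- The set `S` has contact of second order at `q` with a smooth hypersurface `{H = 0}`. The notion
does not depend on the coordinates used. -/
def HasSecondOrderContact (S : Set (HypSpace m)) (q : HypSpace m) : Prop :=
  ∃ H : EuclideanSpace ℝ (Fin m) × ℝ → ℝ, ContDiffAt ℝ 2 H (horoCoord q) ∧
    fderiv ℝ H (horoCoord q) ≠ 0 ∧
    (fun p => H (horoCoord p)) =o[𝓝[S] q] fun p => ‖horoCoord p - horoCoord q‖ ^ 2

theorem HasSecondOrderContact.image {S : Set (HypSpace m)} {q : HypSpace m}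
    (h : HasSecondOrderContact S q) {φ : HypSpace m ≃ᵢ HypSpace m} (hφ : IsSmoothIsometry φ) :
    HasSecondOrderContact (φ '' S) (φ q) := by
  obtain ⟨H, hH, hH0, ho⟩ := h
  set F := fun v : EuclideanSpace ℝ (Fin m) × ℝ => horoCoord (φ (horoPoint v.1 v.2)) with hF
  set G := fun v : EuclideanSpace ℝ (Fin m) × ℝ => horoCoord (φ.symm (horoPoint v.1 v.2)) with hG
  have hFc : ∀ p, F (horoCoord p) = horoCoord (φ p) := fun p => by
    rw [hF]; simp only [horoPoint_horoCoord]
  have hGc : ∀ p, G (horoCoord (φ p)) = horoCoord p := fun p => by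
    rw [hG]; simp only [horoPoint_horoCoord, φ.symm_apply_apply]
  have hGF : ∀ v, G (F v) = v := fun v => by
    rw [hF]; simp only; rw [hGc, horoCoord_horoPoint]
  have hHG : ContDiffAt ℝ 2 (H ∘ G) (horoCoord (φ q)) := by
    refine ContDiffAt.comp _ ?_ hφ.contDiff_symm.contDiffAt
    rwa [hGc]
  refine ⟨H ∘ G, hHG, fun h0 => hH0 ?_, ?_⟩
  · have h1 : H = (H ∘ G) ∘ F := by ext v; simp [hGF]
    have h2 : DifferentiableAt ℝ (H ∘ G) (F (horoCoord q)) := by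
      rw [hFc]; exact hHG.differentiableAt (by simp)
    rw [h1, fderiv_comp _ h2 (hφ.contDiff.differentiable (by simp) _), hFc, h0,
      ContinuousLinearMap.zero_comp]
  · have hmap : 𝓝[φ '' S] (φ q) = map φ (𝓝[S] q) :=
      (φ.toHomeomorph.isEmbedding.map_nhdsWithin_eq S q).symm
    rw [hmap, isLittleO_map]
    refine IsLittleO.congr_left (f₁ := fun p => H (horoCoord p)) ?_ (fun p => by simp [hGc])
    suffices hO : (fun p => ‖horoCoord p - horoCoord q‖) =O[𝓝[S] q]
        fun p => ‖horoCoord (φ p) - horoCoord (φ q)‖ by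
      have h2 := hO.pow 2
      exact ho.trans_isBigO h2
    have hGd : DifferentiableAt ℝ G (horoCoord (φ q)) := hφ.contDiff_symm.differentiable (by simp) _
    have ht : Tendsto (fun p => horoCoord (φ p)) (𝓝[S] q) (𝓝 (horoCoord (φ q))) :=
      ((continuous_horoCoord.comp φ.continuous).tendsto q).mono_left nhdsWithin_le_nhds
    have := (hGd.isBigO_sub.comp_tendsto ht).norm_norm
    refine this.congr_left fun p => ?_
    simp [hGc]

/-- The quadratic part of the expansion may be given by any bilinear form, since only its
symmetric part matters. -/
theorem IsTwiceDiffAt.of_clm {u : EuclideanSpace ℝ (Fin m) → ℝ} {x : EuclideanSpace ℝ (Fin m)}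
    (g : EuclideanSpace ℝ (Fin m))
    (b : EuclideanSpace ℝ (Fin m) →L[ℝ] EuclideanSpace ℝ (Fin m) →L[ℝ] ℝ)
    (h : (fun y => u y - (u x + inner ℝ g (y - x) + (1 / 2) * b (y - x) (y - x)))
      =o[𝓝 x] fun y => ‖y - x‖ ^ 2) : IsTwiceDiffAt u x := by
  set B₀ : EuclideanSpace ℝ (Fin m) →ₗ[ℝ] EuclideanSpace ℝ (Fin m) :=
    { toFun := fun y => (InnerProductSpace.toDual ℝ _).symm (b y)
      map_add' := by simp
      map_smul' := by simp }
  set B := LinearMap.toContinuousLinearMap B₀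
  have hB : ∀ y z, inner ℝ (B y) z = b y z := fun y z =>
    InnerProductSpace.toDual_symm_apply
  refine ⟨g, (1 / 2 : ℝ) • (B + ContinuousLinearMap.adjoint B), fun y z => ?_, ?_⟩
  · simp only [ContinuousLinearMap.coe_coe, smul_apply, add_apply,
      inner_smul_left, inner_smul_right, inner_add_left, inner_add_right,
      ContinuousLinearMap.adjoint_inner_left, ContinuousLinearMap.adjoint_inner_right,
      conj_trivial]
    ring
  · refine h.congr_left fun y => ?_
    simp only [smul_apply, add_apply, inner_smul_left, inner_add_left,
      ContinuousLinearMap.adjoint_inner_left, conj_trivial]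
    rw [← hB, real_inner_comm (B (y - x))]
    ring

variable {E : Type*} [NormedAddCommGroup E] [NormedSpace ℝ E]

/-- A graph of a function with `v(y) = O(|y|)` that has contact of second order with a smooth
hypersurface has a tangent plane. -/
theorem differentiableAt_of_isLittleO {H : E × ℝ → ℝ} {v : E → ℝ}
    (hH : DifferentiableAt ℝ H 0) (hH0 : fderiv ℝ H 0 ≠ 0) (h0 : H 0 = 0)
    (hv : v =O[𝓝 0] fun y => y) (ho : (fun y => H (y, v y)) =o[𝓝 0] fun y => ‖y‖) :
    DifferentiableAt ℝ v 0 := by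
  have hv0 : v 0 = 0 := by simpa using hv.eq_zero_imp.self_of_nhds
  have ht : Tendsto (fun y => (y, v y)) (𝓝 0) (𝓝 (0 : E × ℝ)) := by
    have h1 : Tendsto v (𝓝 0) (𝓝 0) := hv.trans_tendsto tendsto_id
    exact tendsto_id.prodMk_nhds h1
  have hb : (fun y => (y, v y)) =O[𝓝 0] fun y => y := (isBigO_refl _ _).prod_left hv
  have h1 : (fun y => H (y, v y) - fderiv ℝ H 0 (y, v y)) =o[𝓝 0] fun y => y := by
    have h2 := hH.hasFDerivAt.isLittleO.comp_tendsto ht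
    simp only [Function.comp_def, h0, sub_zero] at h2
    exact h2.trans_isBigO hb
  have h3 : (fun y => fderiv ℝ H 0 (y, v y)) =o[𝓝 0] fun y => y := by
    refine (ho.norm_right.of_norm_right.of_norm_right.sub h1).congr_left fun y => ?_
    ring
  set L := fderiv ℝ H 0
  set a := L (0, 1) with ha
  set A := L.comp (ContinuousLinearMap.inl ℝ E ℝ) with hA
  have hsplit : ∀ y : E, ∀ s : ℝ, L (y, s) = A y + s * a := by
    intro y s
    have : (y, s) = (y, (0 : ℝ)) + s • ((0 : E), (1 : ℝ)) := by simp
    rw [this, map_add, map_smul, smul_eq_mul, hA, ContinuousLinearMap.comp_apply,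
      ContinuousLinearMap.inl_apply]
  simp only [hsplit] at h3
  have ha0 : a ≠ 0 := by
    intro ha0
    have h4 : HasFDerivAt (fun y => A y) (0 : E →L[ℝ] ℝ) 0 := by
      refine HasFDerivAt.of_isLittleO ?_
      simpa [ha0] using h3
    have h5 : A = 0 := A.hasFDerivAt.unique h4
    refine hH0 (ContinuousLinearMap.ext fun w => ?_)
    rw [← Prod.mk.eta (p := w), hsplit, ha0, h5]
    simp
  have h6 : HasFDerivAt v (-a⁻¹ • A) 0 := by
    refine HasFDerivAt.of_isLittleO ?_
    refine (h3.const_mul_left a⁻¹).congr (fun y => ?_) (fun y => by simp)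
    simp only [hv0, sub_zero, neg_smul, neg_apply, smul_apply, smul_eq_mul]
    field_simp
    ring
  exact h6.differentiableAt

/-- A graph tangent to the horosphere `{v = 0}` that has contact of second order with a smooth
hypersurface is the graph of a twice differentiable function. -/
theorem isTwiceDiffAt_of_isLittleO {H : EuclideanSpace ℝ (Fin m) × ℝ → ℝ}
    {v : EuclideanSpace ℝ (Fin m) → ℝ} (hH : ContDiffAt ℝ 2 H 0) (hH0 : fderiv ℝ H 0 ≠ 0)
    (hv0 : v 0 = 0) (hv : HasGradientAt v 0 0)
    (ho : (fun y => H (y, v y)) =o[𝓝 0] fun y => ‖y‖ ^ 2) : IsTwiceDiffAt v 0 := by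
  have h0 : H 0 = 0 := by
    have h1 := (ho.bound one_pos).self_of_nhds
    simpa [hv0, Prod.mk_zero_zero] using h1
  have hvo : v =o[𝓝 0] fun y => y := by
    simpa [hv0] using hasGradientAt_iff_isLittleO.1 hv
  have ht : Tendsto (fun y => (y, v y)) (𝓝 0)
      (𝓝 (0 : EuclideanSpace ℝ (Fin m) × ℝ)) := by
    have h1 : Tendsto v (𝓝 0) (𝓝 0) := hvo.trans_tendsto tendsto_id
    exact tendsto_id.prodMk_nhds h1
  have hb : (fun y => (y, v y)) =O[𝓝 0] fun y => y := (isBigO_refl _ _).prod_left hvo.isBigO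
  have hsq : (fun y : EuclideanSpace ℝ (Fin m) => ‖y‖ ^ 2) =o[𝓝 0] fun y => y := by
    have h1 := isLittleO_norm_pow_id (E' := EuclideanSpace ℝ (Fin m)) one_lt_two
    exact h1
  set L := fderiv ℝ H 0 with hL
  set D := fderiv ℝ (fderiv ℝ H) 0 with hD
  have h1 : (fun y => H (y, v y) - (L (y, v y) + (1 / 2) * D (y, v y) (y, v y))) =o[𝓝 0]
      fun y => ‖y‖ ^ 2 := by
    have h2 := hH.isLittleO_taylor_two.comp_tendsto ht
    simp only [Function.comp_def, h0, sub_zero, zero_add] at h2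
    exact h2.trans_isBigO (hb.norm_norm.pow 2)
  set a := L (0, 1) with ha
  set A := L.comp (ContinuousLinearMap.inl ℝ _ ℝ) with hA
  have hsplit : ∀ y, ∀ s : ℝ, L (y, s) = A y + s * a := by
    intro y s
    have : (y, s) = (y, (0 : ℝ)) + s • ((0 : EuclideanSpace ℝ (Fin m)), (1 : ℝ)) := by simp
    rw [this, map_add, map_smul, smul_eq_mul, hA, ContinuousLinearMap.comp_apply,
      ContinuousLinearMap.inl_apply]
  -- the mixed and the vertical second order terms are negligible
  have h3 : (fun y => D (y, v y) (y, v y) - D (y, 0) (y, 0)) =o[𝓝 0] fun y => ‖y‖ ^ 2 := by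
    have hvn : (fun y => ((0 : EuclideanSpace ℝ (Fin m)), v y)) =o[𝓝 0] fun y => ‖y‖ :=
      (IsLittleO.prod_left (isLittleO_zero _ _) hvo).norm_right
    have hyn : (fun y : EuclideanSpace ℝ (Fin m) => (y, (0 : ℝ))) =O[𝓝 0] fun y => ‖y‖ :=
      ((isBigO_refl _ _).prod_left (isBigO_zero _ _)).norm_right
    have e1 : (fun y => D (y, v y) (0, v y)) =o[𝓝 0] fun y => ‖y‖ ^ 2 := by
      simp only [pow_two]
      refine IsBigO.trans_isLittleO (g := fun y => ‖(y, v y)‖ * ‖((0 : EuclideanSpace ℝ (Fin m)),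
        v y)‖) ?_ (hb.norm_norm.mul_isLittleO hvn.norm_left)
      refine IsBigO.of_bound ‖D‖ (Eventually.of_forall fun y => ?_)
      rw [norm_mul, norm_norm, norm_norm, ← mul_assoc]
      exact D.le_opNorm₂ (y, v y) (0, v y)
    have e2 : (fun y => D (0, v y) (y, 0)) =o[𝓝 0] fun y => ‖y‖ ^ 2 := by
      simp only [pow_two]
      refine IsBigO.trans_isLittleO (g := fun y => ‖((0 : EuclideanSpace ℝ (Fin m)),
        v y)‖ * ‖(y, (0 : ℝ))‖) ?_ (hvn.norm_left.mul_isBigO hyn.norm_left)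
      refine IsBigO.of_bound ‖D‖ (Eventually.of_forall fun y => ?_)
      rw [norm_mul, norm_norm, norm_norm, ← mul_assoc]
      exact D.le_opNorm₂ (0, v y) (y, 0)
    refine (e1.add e2).congr_left fun y => ?_
    have e3 : (y, v y) = (y, (0 : ℝ)) + ((0 : EuclideanSpace ℝ (Fin m)), v y) := by simp
    rw [e3]
    simp only [map_add, add_apply]
    ring
  have h4 : (fun y => A y + v y * a + (1 / 2) * D (y, 0) (y, 0)) =o[𝓝 0] fun y => ‖y‖ ^ 2 := by
    refine ((ho.sub h1).sub (h3.const_mul_left (1 / 2))).congr_left fun y => ?_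
    rw [hsplit]
    ring
  have hA0 : A = 0 := by
    have h5 : HasFDerivAt (fun y => A y) (0 : EuclideanSpace ℝ (Fin m) →L[ℝ] ℝ) 0 := by
      refine HasFDerivAt.of_isLittleO ?_
      have e1 : (fun y => (1 / 2) * D (y, 0) (y, 0)) =O[𝓝 0] fun y => ‖y‖ ^ 2 := by
        refine IsBigO.of_bound ((1 / 2) * ‖D‖) (Eventually.of_forall fun y => ?_)
        have := D.le_opNorm₂ (y, 0) (y, 0)
        simp only [norm_mul, norm_pow, norm_norm, Prod.norm_mk, norm_zero, norm_nonneg,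
          sup_of_le_left] at this ⊢
        norm_num
        rw [Real.norm_eq_abs] at this
        linarith
      refine (((h4.trans hsq).sub (e1.trans_isLittleO hsq)).sub
        (hvo.const_mul_left a)).congr (fun y => ?_) (fun y => by simp)
      simp
      ring
    exact A.hasFDerivAt.unique h5
  have ha0 : a ≠ 0 := by
    intro ha0
    refine hH0 (ContinuousLinearMap.ext fun w => ?_)
    rw [← Prod.mk.eta (p := w), hsplit, ha0, hA0]
    simp
  refine IsTwiceDiffAt.of_clm 0
    ((-a⁻¹) • (ContinuousLinearMap.bilinearComp D (ContinuousLinearMap.inl ℝ _ ℝ)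
      (ContinuousLinearMap.inl ℝ _ ℝ))) ?_
  refine (h4.const_mul_left a⁻¹).congr (fun y => ?_) (fun y => by simp)
  simp [hA0, hv0]
  field_simp

end SecondOrder

/-! ### The boundary as a graph -/

open Filter in
/-- Below an interior point, the boundary of a compact convex set is the graph of a convex
function. -/
theorem Convex.exists_local_graph {F : Type*} [NormedAddCommGroup F] [NormedSpace ℝ F]
    {C : Set (F × ℝ)} (hC : Convex ℝ C) (hc : IsCompact C) {x₀ : F} {t : ℝ}
    (ht : (x₀, t) ∈ interior C) :
    ∃ (ε : ℝ) (f : F → ℝ), 0 < ε ∧ ConvexOn ℝ (Metric.ball x₀ ε) f ∧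
      ∀ x ∈ Metric.ball x₀ ε, f x < t ∧
        ∀ w < t, ((x, w) ∈ C ∧ (x, w) ∉ interior C) ↔ w = f x := by
  have hcont : Continuous fun x : F => (x, t) := by fun_prop
  obtain ⟨ε, hε, hball⟩ := Metric.eventually_nhds_iff_ball.1
    ((hcont.tendsto x₀).eventually (isOpen_interior.mem_nhds ht))
  set S : F → Set ℝ := fun x => {w | (x, w) ∈ C} with hS
  have hSc : ∀ x, IsCompact (S x) := by
    intro x
    have h1 : S x = Prod.snd '' (C ∩ Prod.fst ⁻¹' {x}) := by
      ext w
      constructor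
      · exact fun h => ⟨(x, w), ⟨h, rfl⟩, rfl⟩
      · rintro ⟨⟨y, w'⟩, ⟨h, rfl⟩, rfl⟩
        exact h
    rw [h1]
    exact (hc.inter_right (isClosed_singleton.preimage continuous_fst)).image continuous_snd
  set f : F → ℝ := fun x => sInf (S x) with hf
  have hfm : ∀ x ∈ Metric.ball x₀ ε, (x, f x) ∈ C := fun x hx =>
    (hSc x).sInf_mem ⟨t, show (x, t) ∈ C from interior_subset (hball x hx)⟩
  have hfle : ∀ x w, (x, w) ∈ C → f x ≤ w := fun x w h => csInf_le (hSc x).bddBelow h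
  have hlow : ∀ x w, (x, w) ∈ interior C → f x < w := by
    intro x w h
    have h1 : Tendsto (fun s : ℝ => (x, s)) (𝓝[<] w) (𝓝 (x, w)) :=
      ((by fun_prop : Continuous fun s : ℝ => (x, s)).tendsto w).mono_left nhdsWithin_le_nhds
    obtain ⟨s, hs, hsw⟩ := ((h1.eventually (isOpen_interior.mem_nhds h)).and
      self_mem_nhdsWithin).exists
    exact (hfle x s (interior_subset hs)).trans_lt hsw
  refine ⟨ε, f, hε, ⟨convex_ball _ _, fun x hx y hy a b ha hb hab => ?_⟩, fun x hx => ⟨?_, ?_⟩⟩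
  · exact hfle _ _ (by simpa using hC (hfm x hx) (hfm y hy) ha hb hab)
  · exact hlow x t (hball x hx)
  · intro w hw
    constructor
    · rintro ⟨h1, h2⟩
      by_contra hne
      have hlt : f x < w := lt_of_le_of_ne (hfle x w h1) (Ne.symm hne)
      refine h2 (hC.openSegment_self_interior_subset_interior (hfm x hx) (hball x hx) ?_)
      rw [← Prod.image_mk_openSegment_right]
      exact ⟨w, by rw [openSegment_eq_Ioo (hlt.trans hw)]; exact ⟨hlt, hw⟩, rfl⟩
    · rintro rfl
      exact ⟨hfm x hx, fun h => lt_irrefl _ (hlow _ _ h)⟩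

theorem klein_horoPoint (x : EuclideanSpace ℝ (Fin m)) (s : ℝ) :
    klein (horoPoint x s) = (x, Real.exp (-2 * s) + ‖x‖ ^ 2) := by
  simp only [klein, horoPoint_x, horoPoint_z, ← Real.exp_nat_mul]
  push_cast
  rw [add_comm]
  congr 3
  ring

/-- If a vertical geodesic meets `∂K` at `(0, 1)` and then the interior of `K`, then near `(0, 1)`
the boundary is the graph of a horoconvex function. -/
theorem IsHypConvexBody.exists_horoGraph {K : Set (HypSpace m)} (hK : IsHypConvexBody K)
    (hq : horoPoint 0 0 ∈ frontier K) {t : ℝ} (ht : 0 < t)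
    (ho : horoPoint 0 (-t) ∈ interior K) :
    ∃ (ε : ℝ) (u : EuclideanSpace ℝ (Fin m) → ℝ), 0 < ε ∧ IsHoroconvexOn ε u ∧ u 0 = 0 ∧
      ∃ U : Set (HypSpace m), IsOpen U ∧ frontier K ∩ U = horoGraph ε u := by
  have hfr : ∀ p, p ∈ frontier K ↔ klein p ∈ klein '' K ∧ klein p ∉ interior (klein '' K) := by
    intro p
    rw [klein_mem_interior_image_iff, klein_injective.mem_set_image,
      hK.isCompact.isClosed.frontier_eq, Set.mem_sdiff]
  have ho' := klein_mem_interior_image_iff.2 ho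
  rw [klein_horoPoint] at ho'
  obtain ⟨ε, f, hε, hf, hgr⟩ := hK.convex.convex_image_klein.exists_local_graph
    (hK.isCompact.image continuous_klein) ho'
  set T := Real.exp (-2 * -t) + ‖(0 : EuclideanSpace ℝ (Fin m))‖ ^ 2 with hT
  set u : EuclideanSpace ℝ (Fin m) → ℝ := fun x => -(Real.log (f x - ‖x‖ ^ 2) / 2) with hu
  have hku : ∀ x ∈ Metric.ball 0 ε, klein (horoPoint x (u x)) = (x, f x) := by
    intro x hx
    obtain ⟨p, -, hp⟩ := (((hgr x hx).2 (f x) (hgr x hx).1).2 rfl).1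
    refine klein_kleinInv (v := (x, f x)) ?_
    rw [← hp]
    exact klein_mem p
  have h0 : f 0 = 1 := by
    have h1 := (hfr _).1 hq
    rw [klein_horoPoint] at h1
    have h2 := ((hgr 0 (Metric.mem_ball_self hε)).2 _ ?_).1 h1
    · rw [← h2]; simp
    · have : Real.exp (-2 * 0) < Real.exp (-2 * -t) := Real.exp_lt_exp.2 (by linarith)
      rw [hT]; gcongr
  refine ⟨ε, u, hε, ?_, by simp [hu, h0], {p | p.x ∈ Metric.ball 0 ε ∧ (klein p).2 < T}, ?_, ?_⟩
  · refine hf.congr fun x hx => ?_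
    have := hku x hx
    rw [klein_horoPoint, Prod.mk.injEq] at this
    exact this.2.symm
  · exact (Metric.isOpen_ball.preimage continuous_x).inter
      (isOpen_lt (continuous_snd.comp continuous_klein) continuous_const)
  · ext p
    constructor
    · rintro ⟨h1, h2, h3⟩
      refine ⟨p.x, h2, klein_injective ?_⟩
      simp only
      rw [hku p.x h2]
      have h4 := ((hgr p.x h2).2 _ h3).1 ((hfr p).1 h1)
      rw [← h4]
      rfl
    · rintro ⟨x, hx, rfl⟩
      have h1 := hku x hx
      refine ⟨(hfr _).2 ?_, hx, ?_⟩
      · simp only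
        rw [h1]
        exact ((hgr x hx).2 (f x) (hgr x hx).1).2 rfl
      · simp only
        rw [h1]
        exact (hgr x hx).1

/-! ### Points of second order contact are normal -/

/-- A graph that is differentiable at a point admits at most one support hyperplane there: a
functional that is minimal at the point vanishes on the tangent plane. -/
theorem IsSupportHyperplane.eq_of_hasGradientAt {K : Set (HypSpace m)}
    {f : EuclideanSpace ℝ (Fin m) → ℝ} {q : HypSpace m} {P P' : Set (HypSpace m)}
    {g : EuclideanSpace ℝ (Fin m)} (hf : HasGradientAt f g q.x)
    (hq : klein q = (q.x, f q.x)) (hgraph : ∀ᶠ x in 𝓝 q.x, (x, f x) ∈ klein '' K)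
    (hP : IsSupportHyperplane K q P) (hP' : IsSupportHyperplane K q P') : P = P' := by
  have key : ∀ P, IsSupportHyperplane K q P → P = {p : HypSpace m | (klein p).2 - f q.x -
      inner ℝ g ((klein p).1 - q.x) = 0} := by
    rintro P hP
    obtain ⟨ℓ, h0, rfl, hK⟩ := isSupportHyperplane_iff.1 hP
    set α := ℓ (0, 1) with hα
    set A := ℓ.comp (ContinuousLinearMap.inl ℝ (EuclideanSpace ℝ (Fin m)) ℝ) with hA
    have hsplit : ∀ v, ℓ v = A v.1 + α * v.2 := by
      intro v
      rw [strongDual_prod_apply, InnerProductSpace.toDual_symm_apply, add_comm]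
    have hmin : IsLocalMin (fun x => A x + α * f x) q.x := by
      filter_upwards [hgraph] with x hx
      obtain ⟨p, hp, hpx⟩ := hx
      have h1 := hK p hp
      rw [hpx, hq, hsplit, hsplit] at h1
      exact h1
    have hd := hmin.hasFDerivAt_eq_zero (A.hasFDerivAt.add (hf.hasFDerivAt.const_mul α))
    have hAg : ∀ y, A y = -(α * inner ℝ g y) := by
      intro y
      have := congrArg (fun L => L y) hd
      simp at this
      linarith
    have hα0 : α ≠ 0 := by
      intro h
      exact h0 (ContinuousLinearMap.ext fun v => by simp [hsplit, hAg, h])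
    ext p
    rw [Set.mem_ofPred_eq, Set.mem_ofPred_eq, hsplit, hsplit, hAg, hAg, hq, inner_sub_right]
    constructor
    · intro h
      have : α * ((klein p).2 - f q.x - (inner ℝ g (klein p).1 - inner ℝ g q.x)) = 0 := by
        linear_combination h
      exact (mul_eq_zero.1 this).resolve_left hα0
    · intro h
      linear_combination α * h
  rw [key P hP, key P' hP']

open Filter in
/-- If the unit hemisphere is the only support hyperplane at `(0, 1)`, then the vertical geodesic
from `(0, 1)` enters the interior: otherwise separate it from the interior. -/
theorem IsHypConvexBody.eventually_mem_interior {K : Set (HypSpace m)} (hK : IsHypConvexBody K)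
    (hq : horoPoint 0 0 ∈ frontier K)
    (huniq : ∀ P, IsSupportHyperplane K (horoPoint 0 0) P →
      P = {p | ‖p.x‖ ^ 2 + p.z ^ 2 = 1})
    (hside : ∀ p ∈ K, 1 ≤ ‖p.x‖ ^ 2 + p.z ^ 2) :
    ∀ᶠ t in 𝓝[>] (0 : ℝ), horoPoint 0 (-t) ∈ interior K := by
  have hC := hK.convex.convex_image_klein
  have hqK : horoPoint 0 0 ∈ K := hK.isCompact.isClosed.frontier_subset hq
  have hkq : klein (horoPoint (0 : EuclideanSpace ℝ (Fin m)) 0) = (0, 1) := by simp [klein]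
  have hqC : ((0 : EuclideanSpace ℝ (Fin m)), (1 : ℝ)) ∈ klein '' K := ⟨_, hqK, hkq⟩
  have hint : (interior (klein '' K)).Nonempty := by
    obtain ⟨o, ho⟩ := hK.nonempty_interior
    exact ⟨_, klein_mem_interior_image_iff.2 ho⟩
  by_cases hex : ∃ w : ℝ, 1 < w ∧ ((0 : EuclideanSpace ℝ (Fin m)), w) ∈ interior (klein '' K)
  · obtain ⟨w, hw1, hw⟩ := hex
    have hlog : 0 < Real.log w / 2 := by have := Real.log_pos hw1; positivity
    filter_upwards [Ioo_mem_nhdsGT hlog] with t ht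
    rw [← klein_mem_interior_image_iff, klein_horoPoint]
    refine hC.openSegment_self_interior_subset_interior hqC hw ?_
    rw [← Prod.image_mk_openSegment_right]
    refine ⟨_, ?_, rfl⟩
    rw [openSegment_eq_Ioo hw1]
    have h1 : 1 < Real.exp (-2 * -t) := Real.one_lt_exp_iff.2 (by linarith [ht.1])
    have h2 : Real.exp (-2 * -t) < w := by
      rw [← Real.lt_log_iff_exp_lt (by linarith)]
      linarith [ht.2]
    rw [norm_zero, zero_pow two_ne_zero, add_zero]
    exact ⟨h1, h2⟩
  · exfalso
    push Not at hex
    obtain ⟨ℓ, s, h1, h2⟩ := geometric_hahn_banach_open hC.interior isOpen_interior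
      ((convex_singleton (0 : EuclideanSpace ℝ (Fin m))).prod (convex_Ioi (1 : ℝ)))
      (Set.disjoint_left.2 fun v hv hv' => by
        obtain ⟨h3, h4⟩ := hv'
        have h3 : v.1 = 0 := h3
        refine hex v.2 h4 ?_
        rwa [← h3])
    have hcl : ∀ v ∈ klein '' K, ℓ v ≤ s := by
      intro v hv
      have h3 : v ∈ closure (interior (klein '' K)) := by
        rw [hC.closure_interior_eq_closure_of_nonempty_interior hint]
        exact subset_closure hv
      exact closure_minimal (t := {v | ℓ v ≤ s}) (fun v hv => (h1 v hv).le)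
        (isClosed_le ℓ.continuous continuous_const) h3
    have hray : ∀ r : ℝ, 1 < r → s ≤ r * ℓ (0, 1) := by
      intro r hr
      have h3 := h2 (0, r) ⟨rfl, hr⟩
      have h4 : ((0 : EuclideanSpace ℝ (Fin m)), r) = r • (0, (1 : ℝ)) := by simp
      rwa [h4, map_smul, smul_eq_mul] at h3
    have hq1 := hcl _ hqC
    have hnn : 0 ≤ ℓ (0, 1) := by
      have := hray 2 one_lt_two
      linarith
    have hqs : s ≤ ℓ (0, 1) := by
      refine le_of_forall_pos_le_add fun η hη => ?_
      rcases hnn.eq_or_lt with h | h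
      · have := hray 2 one_lt_two
        linarith
      · have h3 := hray (1 + η / ℓ (0, 1)) (by simpa using div_pos hη h)
        rw [add_mul, div_mul_cancel₀ _ h.ne'] at h3
        linarith
    have hℓ0 : -ℓ ≠ 0 := by
      intro h
      obtain ⟨v, hv⟩ := hint
      have h3 := h1 v hv
      have h4 : ℓ = 0 := neg_eq_zero.1 h
      simp [h4] at h3 hqs
      linarith
    have hsupp := huniq _ (isSupportHyperplane_iff.2 ⟨-ℓ, hℓ0, rfl, fun p hp => by
      rw [hkq]
      have := hcl _ ⟨p, hp, rfl⟩
      simp only [neg_apply]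
      linarith⟩)
    -- the hyperplane of `ℓ` is the unit hemisphere, so `ℓ` is a multiple of the height
    have hker : ∀ x : EuclideanSpace ℝ (Fin m), ℓ (x, 0) = 0 := by
      intro x
      set c : ℝ := (1 + ‖x‖)⁻¹ with hc
      have hc0 : 0 < c := by positivity
      have hcx : ‖c • x‖ ^ 2 < 1 := by
        have h3 : ‖c • x‖ < 1 := by
          rw [norm_smul, Real.norm_of_nonneg hc0.le, hc, inv_mul_lt_one₀ (by positivity)]
          linarith
        nlinarith [norm_nonneg (c • x)]
      have h3 := klein_kleinInv (v := (c • x, (1 : ℝ))) hcx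
      have h4 : kleinInv (c • x, (1 : ℝ)) ∈
          {p : HypSpace m | ‖p.x‖ ^ 2 + p.z ^ 2 = 1} := congrArg Prod.snd h3
      rw [← hsupp, Set.mem_ofPred_eq, h3, hkq] at h4
      have h5 : (c • x, (1 : ℝ)) = c • (x, (0 : ℝ)) + (0, 1) := by simp
      rw [h5] at h4
      simp only [neg_apply, map_add, map_smul, smul_eq_mul] at h4
      exact (mul_eq_zero.1 (by linarith : c * ℓ (x, 0) = 0)).resolve_left hc0.ne'
    obtain ⟨o, ho⟩ := hK.nonempty_interior
    have h3 := h1 _ (klein_mem_interior_image_iff.2 ho)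
    have h4 : klein o = ((klein o).1, 0) + (klein o).2 • ((0 : EuclideanSpace ℝ (Fin m)),
      (1 : ℝ)) := by ext1 <;> simp
    rw [h4, map_add, hker, map_smul, smul_eq_mul, zero_add] at h3
    have h5 : 1 ≤ (klein o).2 := hside o (interior_subset ho)
    nlinarith

open Asymptotics Filter

theorem exists_lipschitzOnWith_of_contDiffAt_comp {E : Type*} [NormedAddCommGroup E] {g : ℝ → ℝ}
    {f : E → ℝ} {x : E} {C : NNReal} {t : Set E} (ht : t ∈ 𝓝 x) (hf : LipschitzOnWith C f t)
    (hg : ContDiffAt ℝ 1 g (f x)) : ∃ C, ∃ t ∈ 𝓝 x, LipschitzOnWith C (fun y => g (f y)) t := by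
  obtain ⟨C', s, hs, hL⟩ := hg.exists_lipschitzOnWith
  have hc : ContinuousAt f x := hf.continuousOn.continuousAt ht
  exact ⟨_, _, inter_mem ht (hc hs), hL.comp (hf.mono Set.inter_subset_left) fun y hy => hy.2⟩

theorem IsHoroconvexOn.exists_lipschitzOnWith {ε : ℝ} {u : EuclideanSpace ℝ (Fin m) → ℝ}
    (hu : IsHoroconvexOn ε u) (hε : 0 < ε) :
    ∃ C, ∃ t ∈ 𝓝 (0 : EuclideanSpace ℝ (Fin m)), LipschitzOnWith C u t := by
  have h1 := ConvexOn.locallyLipschitzOn Metric.isOpen_ball hu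
  obtain ⟨C, t, ht, hL⟩ := h1 (Metric.mem_ball_self hε)
  rw [Metric.isOpen_ball.nhdsWithin_eq (Metric.mem_ball_self hε)] at ht
  have h2 : ContDiffAt ℝ 1 (fun x : EuclideanSpace ℝ (Fin m) => ‖x‖ ^ 2) 0 :=
    (contDiff_norm_sq ℝ).contDiffAt
  obtain ⟨C', t', ht', hL'⟩ := h2.exists_lipschitzOnWith
  have h3 := (hL.mono (Set.inter_subset_left (t := t'))).sub
    (hL'.mono (Set.inter_subset_right (s := t)))
  simp only [add_sub_cancel_right] at h3
  obtain ⟨C'', t'', ht'', hL''⟩ := exists_lipschitzOnWith_of_contDiffAt_comp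
    (g := fun s => -(Real.log s / 2)) (inter_mem ht ht') h3 (by
      have : ContDiffAt ℝ 1 Real.log (Real.exp (-2 * u 0)) :=
        Real.contDiffAt_log.2 (Real.exp_pos _).ne'
      exact (this.div_const 2).neg)
  have hfun : (fun y => -(Real.log (Real.exp (-2 * u y)) / 2)) = u := by
    ext y
    rw [Real.log_exp]
    ring
  exact ⟨C'', t'', ht'', hfun ▸ hL''⟩

/-- A boundary point with at most one support hyperplane at which the boundary has contact of
second order with a smooth hypersurface is normal. -/
theorem IsHypConvexBody.isNormalPoint {K : Set (HypSpace m)} (hK : IsHypConvexBody K)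
    {q : HypSpace m} (hq : q ∈ frontier K)
    (huniq : ∀ P P', IsSupportHyperplane K q P → IsSupportHyperplane K q P' → P = P')
    (hc : HasSecondOrderContact (frontier K) q) : IsNormalPoint K q := by
  obtain ⟨P, hP⟩ := hK.exists_isSupportHyperplane hq
  obtain ⟨φ, hφ, hφq, hφP, hside⟩ := hP.exists_isSmoothIsometry
  have hK' := hK.image φ
  have hfr : frontier (φ '' K) = φ '' frontier K := (φ.toHomeomorph.image_frontier K).symm
  have hin : interior (φ '' K) = φ '' interior K := (φ.toHomeomorph.image_interior K).symm
  have hq' : horoPoint 0 0 ∈ frontier (φ '' K) := by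
    rw [hfr, ← hφq]
    exact ⟨q, hq, rfl⟩
  have hsupp : ∀ P', IsSupportHyperplane K q P' → φ '' P' = {p | ‖p.x‖ ^ 2 + p.z ^ 2 = 1} :=
    fun P' hP' => by rw [huniq P' P hP' hP, hφP]
  have hev := hK'.eventually_mem_interior hq' (fun P' hP' => by
    have h1 := hP'.image φ.symm
    have h2 : φ.symm '' (φ '' K) = K := by
      rw [Set.image_image]; simp
    rw [h2, ← hφq, φ.symm_apply_apply] at h1
    rw [← hsupp _ h1, Set.image_image]
    simp) hside
  obtain ⟨t, ht, ht0⟩ := (hev.and self_mem_nhdsWithin).exists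
  obtain ⟨ε, u, hε, hu, hu0, U, hU, hgr⟩ := hK'.exists_horoGraph hq' ht0 ht
  have hball : Metric.ball (0 : EuclideanSpace ℝ (Fin m)) ε ∈ 𝓝 0 := Metric.ball_mem_nhds _ hε
  have hgrm : ∀ x ∈ Metric.ball 0 ε, horoPoint x (u x) ∈ frontier (φ '' K) := fun x hx =>
    (hgr.ge ⟨x, hx, rfl⟩).1
  obtain ⟨C, s, hs, hL⟩ := hu.exists_lipschitzOnWith hε
  have hO : u =O[𝓝 0] fun y => y := by
    refine IsBigO.of_bound C (mem_of_superset hs fun y hy => ?_)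
    have := hL.dist_le_mul y hy 0 (mem_of_mem_nhds hs)
    simpa [hu0] using this
  have htend : Tendsto (fun y => (y, u y)) (𝓝 0) (𝓝 (0 : EuclideanSpace ℝ (Fin m) × ℝ)) := by
    have h1 : Tendsto u (𝓝 0) (𝓝 0) := hO.trans_tendsto tendsto_id
    exact tendsto_id.prodMk_nhds h1
  have hbig : (fun y => (y, u y)) =O[𝓝 0] fun y => y := (isBigO_refl _ _).prod_left hO
  have hc' := hc.image hφ
  rw [← hfr, hφq] at hc'
  have hbase : horoCoord (horoPoint (0 : EuclideanSpace ℝ (Fin m)) 0) = 0 :=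
    horoCoord_horoPoint (0, 0)
  obtain ⟨H, hH, hH0, ho⟩ := hc'
  rw [hbase] at hH hH0 ho
  have hmap : Tendsto (fun y => horoPoint y (u y)) (𝓝 0) (𝓝[frontier (φ '' K)] (horoPoint 0 0)) :=
    tendsto_nhdsWithin_iff.2 ⟨(continuous_horoPoint.tendsto 0).comp htend,
      mem_of_superset hball hgrm⟩
  have ho2 : (fun y => H (y, u y)) =o[𝓝 0] fun y => ‖y‖ ^ 2 := by
    have h1 := ho.comp_tendsto hmap
    have h2 : ∀ y, horoCoord (horoPoint y (u y)) = (y, u y) := fun y =>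
      horoCoord_horoPoint (y, u y)
    simp only [Function.comp_def, h2, sub_zero] at h1
    have h3 := hbig.norm_norm.pow 2
    exact h1.trans_isBigO h3
  have hsq : (fun y : EuclideanSpace ℝ (Fin m) => ‖y‖ ^ 2) =o[𝓝 0] fun y => ‖y‖ := by
    have h1 := isLittleO_norm_pow_id (E' := EuclideanSpace ℝ (Fin m)) one_lt_two
    exact h1.norm_right
  have h0 : H 0 = 0 := by
    have h1 := (ho2.bound one_pos).self_of_nhds
    simpa [hu0, Prod.mk_zero_zero] using h1
  have hdiff := differentiableAt_of_isLittleO (hH.differentiableAt (by simp)) hH0 h0 hO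
    (ho2.trans hsq)
  -- the height `e^{-2u} + |x|²` is minimal at `0` because the body lies outside the hemisphere
  have hgrad : HasGradientAt u 0 0 := by
    have hmin : IsLocalMin (fun x => Real.exp (-2 * u x) + ‖x‖ ^ 2) 0 := by
      filter_upwards [hball] with x hx
      have h1 := hside _ (hK'.isCompact.isClosed.frontier_subset (hgrm x hx))
      have h2 := congrArg Prod.snd (klein_horoPoint x (u x))
      change ‖(horoPoint x (u x)).x‖ ^ 2 + (horoPoint x (u x)).z ^ 2 = _ at h2
      rw [h2] at h1
      simpa [hu0] using h1
    have hd := hmin.hasFDerivAt_eq_zero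
      ((hdiff.hasFDerivAt.const_mul (-2)).exp.add (hasStrictFDerivAt_norm_sq 0).hasFDerivAt)
    have h1 : fderiv ℝ u 0 = 0 := by
      ext y
      have := congrArg (fun L => L y) hd
      simpa [hu0] using this
    rw [hasGradientAt_iff_hasFDerivAt, map_zero, ← h1]
    exact hdiff.hasFDerivAt
  refine ⟨⟨hq, P, hP, fun P' hP' => huniq P' P hP' hP⟩, φ, ⟨hφq, hsupp, ?_⟩, ε, u, hε,
    ⟨hu, ⟨U, hU, ?_⟩, hu0, hgrad⟩, isTwiceDiffAt_of_isLittleO hH hH0 hu0 hgrad ho2⟩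
  · filter_upwards [hev] with t ht
    rw [hin] at ht
    obtain ⟨p, hp, hpe⟩ := ht
    rwa [← hpe, φ.symm_apply_apply]
  · rw [← hfr, hgr]

/-! ### Almost every boundary point -/

open Asymptotics Filter MeasureTheory

/-- A second order expansion of the height function `e^{-2u} + |x|²` of a graph gives contact of
second order. -/
theorem hasSecondOrderContact_horoPoint {S U : Set (HypSpace m)} {ε : ℝ}
    {u : EuclideanSpace ℝ (Fin m) → ℝ} (hU : IsOpen U) (hgr : S ∩ U = horoGraph ε u)
    {x₀ g : EuclideanSpace ℝ (Fin m)} (hx₀ : x₀ ∈ Metric.ball 0 ε)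
    {B : EuclideanSpace ℝ (Fin m) →L[ℝ] EuclideanSpace ℝ (Fin m)}
    (h : (fun y => (Real.exp (-2 * u y) + ‖y‖ ^ 2) - ((Real.exp (-2 * u x₀) + ‖x₀‖ ^ 2) +
      inner ℝ g (y - x₀) + (1 / 2) * inner ℝ (B (y - x₀)) (y - x₀)))
      =o[𝓝 x₀] fun y => ‖y - x₀‖ ^ 2) :
    HasSecondOrderContact S (horoPoint x₀ (u x₀)) := by
  set H : EuclideanSpace ℝ (Fin m) × ℝ → ℝ := fun v => (Real.exp (-2 * v.2) + ‖v.1‖ ^ 2) -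
    ((Real.exp (-2 * u x₀) + ‖x₀‖ ^ 2) + inner ℝ g (v.1 - x₀) +
      (1 / 2) * inner ℝ (B (v.1 - x₀)) (v.1 - x₀)) with hH
  have hHs : ContDiff ℝ 2 H := by
    have h1 : ContDiff ℝ 2 fun v : EuclideanSpace ℝ (Fin m) × ℝ => ‖v.1‖ ^ 2 :=
      contDiff_fst.norm_sq ℝ
    have h2 : ContDiff ℝ 2 fun v : EuclideanSpace ℝ (Fin m) × ℝ => inner ℝ g (v.1 - x₀) :=
      contDiff_const.inner ℝ (contDiff_fst.sub contDiff_const)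
    have h3 : ContDiff ℝ 2 fun v : EuclideanSpace ℝ (Fin m) × ℝ =>
        inner ℝ (B (v.1 - x₀)) (v.1 - x₀) :=
      (B.contDiff.comp (contDiff_fst.sub contDiff_const)).inner ℝ (contDiff_fst.sub contDiff_const)
    have h4 : ContDiff ℝ 2 fun v : EuclideanSpace ℝ (Fin m) × ℝ => Real.exp (-2 * v.2) := by
      fun_prop
    exact (h4.add h1).sub ((contDiff_const.add h2).add (contDiff_const.mul h3))
  have hcoord : ∀ x, horoCoord (horoPoint x (u x)) = (x, u x) := fun x =>
    horoCoord_horoPoint (x, u x)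
  refine ⟨H, hHs.contDiffAt, fun h0 => ?_, ?_⟩
  · rw [hcoord] at h0
    have h1 : HasDerivAt (fun s : ℝ => (x₀, s)) ((0 : EuclideanSpace ℝ (Fin m)), (1 : ℝ)) (u x₀) :=
      (hasDerivAt_const _ _).prodMk (hasDerivAt_id _)
    have h2 := ((hHs.differentiable (by simp) (x₀, u x₀)).hasFDerivAt).comp_hasDerivAt (u x₀) h1
    have h3 : HasDerivAt (H ∘ fun s : ℝ => (x₀, s)) (Real.exp (-2 * u x₀) * -2) (u x₀) := by
      have h4 := ((((hasDerivAt_id (u x₀)).const_mul (-2)).exp).add_const (‖x₀‖ ^ 2)).sub_const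
        ((Real.exp (-2 * u x₀) + ‖x₀‖ ^ 2) + inner ℝ g (x₀ - x₀) +
          (1 / 2) * inner ℝ (B (x₀ - x₀)) (x₀ - x₀))
      rwa [mul_one] at h4
    have h5 := h2.unique h3
    rw [h0, zero_apply] at h5
    have := Real.exp_pos (-2 * u x₀)
    linarith
  · have hq : horoPoint x₀ (u x₀) ∈ U := (hgr.ge ⟨x₀, hx₀, rfl⟩).2
    have ht : Tendsto (fun p : HypSpace m => p.x) (𝓝[S] (horoPoint x₀ (u x₀))) (𝓝 x₀) :=
      (continuous_x.tendsto (horoPoint x₀ (u x₀))).mono_left nhdsWithin_le_nhds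
    have h1 := h.comp_tendsto ht
    have h2 : (fun p : HypSpace m => ‖p.x - x₀‖) =O[𝓝[S] (horoPoint x₀ (u x₀))]
        fun p => ‖horoCoord p - horoCoord (horoPoint x₀ (u x₀))‖ := by
      refine IsBigO.of_bound 1 (Eventually.of_forall fun p => ?_)
      rw [norm_norm, norm_norm, one_mul, hcoord]
      exact norm_fst_le (horoCoord p - (x₀, u x₀))
    have h3 := h1.trans_isBigO (h2.pow 2)
    refine h3.congr' ?_ EventuallyEq.rfl
    filter_upwards [self_mem_nhdsWithin, nhdsWithin_le_nhds (hU.mem_nhds hq)] with p hpS hpU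
    obtain ⟨x, -, rfl⟩ := hgr.le ⟨hpS, hpU⟩
    simp only [Function.comp_def, horoPoint_x, hcoord, hH]

theorem dist_horoPoint_le (ξ ξ' : EuclideanSpace ℝ (Fin m)) (ζ ζ' : ℝ) :
    dist (horoPoint ξ ζ) (horoPoint ξ' ζ') ≤ |ζ - ζ'| + Real.exp ζ' * ‖ξ - ξ'‖ := by
  refine (dist_triangle _ (horoPoint ξ ζ') _).trans (add_le_add (le_of_eq ?_) ?_)
  · refine dist_eq_of_cosh (abs_nonneg _) ?_
    rw [cosh_dist, Real.cosh_abs, Real.cosh_eq]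
    simp only [horoPoint_x, horoPoint_z, sub_self, norm_zero, Real.exp_sub, neg_sub, Real.exp_neg]
    field_simp
    ring
  · have h1 : dist (horoPoint ξ ζ').toEuc (horoPoint ξ' ζ').toEuc = ‖ξ - ξ'‖ := by
      rw [← sq_eq_sq₀ dist_nonneg (norm_nonneg _), dist_toEuc_sq]
      simp
    have h2 : Real.arsinh (‖ξ - ξ'‖ / (2 * Real.exp (-ζ'))) ≤
        ‖ξ - ξ'‖ / (2 * Real.exp (-ζ')) := by
      rw [← Real.sinh_le_sinh, Real.sinh_arsinh, Real.self_le_sinh_iff]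
      positivity
    rw [dist_eq, h1, horoPoint_z, horoPoint_z, Real.sqrt_mul_self (Real.exp_pos _).le]
    calc _ ≤ 2 * (‖ξ - ξ'‖ / (2 * Real.exp (-ζ'))) := by gcongr
      _ = _ := by rw [Real.exp_neg]; field_simp

theorem exists_lipschitzOnWith_horoPoint {u : EuclideanSpace ℝ (Fin m) → ℝ}
    {x : EuclideanSpace ℝ (Fin m)} {C : NNReal} {t : Set (EuclideanSpace ℝ (Fin m))}
    (ht : t ∈ 𝓝 x) (hu : LipschitzOnWith C u t) :
    ∃ C, ∃ t ∈ 𝓝 x, LipschitzOnWith C (fun y => horoPoint y (u y)) t := by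
  have hc : ContinuousAt u x := hu.continuousOn.continuousAt ht
  have h1 : ∀ᶠ y in 𝓝 x, u y < u x + 1 := hc.eventually (gt_mem_nhds (by linarith))
  refine ⟨C + (Real.exp (u x + 1)).toNNReal, _, inter_mem ht h1,
    LipschitzOnWith.of_dist_le_mul fun y hy z hz => ?_⟩
  refine (dist_horoPoint_le _ _ _ _).trans ?_
  have h2 := hu.dist_le_mul y hy.1 z hz.1
  rw [Real.dist_eq] at h2
  rw [NNReal.coe_add, Real.coe_toNNReal _ (Real.exp_pos _).le, add_mul]
  refine add_le_add h2 ?_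
  rw [dist_eq_norm]
  gcongr
  exact le_of_lt hz.2

instance : SecondCountableTopology (HypSpace m) :=
  horoHomeo.isEmbedding.secondCountableTopology

/-- Almost all points of the boundary near a given one are normal. -/
theorem IsHypConvexBody.exists_nhds_hausdorffMeasure_eq_zero {K : Set (HypSpace m)}
    (hK : IsHypConvexBody K) {q : HypSpace m} (hq : q ∈ frontier K) :
    ∃ W ∈ 𝓝 q, Measure.hausdorffMeasure (m : ℝ)
      ({q : HypSpace m | q ∈ frontier K ∧ ¬ IsNormalPoint K q} ∩ W) = 0 := by
  obtain ⟨o, ho⟩ := hK.nonempty_interior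
  have hoq : o ≠ q := by rintro rfl; exact hq.2 ho
  obtain ⟨φ, hφ, hφq, hφo⟩ := exists_isSmoothIsometry_axis hoq
  have hK' := hK.image φ
  have hfr : frontier (φ '' K) = φ '' frontier K := (φ.toHomeomorph.image_frontier K).symm
  have hin : interior (φ '' K) = φ '' interior K := (φ.toHomeomorph.image_interior K).symm
  have hq' : horoPoint 0 0 ∈ frontier (φ '' K) := by
    rw [hfr, ← hφq]
    exact ⟨q, hq, rfl⟩
  obtain ⟨ε, u, hε, hu, hu0, U, hU, hgr⟩ := hK'.exists_horoGraph hq' (dist_pos.2 hoq) (by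
    rw [hin, ← hφo]
    exact ⟨o, ho, rfl⟩)
  set f : EuclideanSpace ℝ (Fin m) → ℝ := fun x => Real.exp (-2 * u x) + ‖x‖ ^ 2 with hf
  have hfc : ConvexOn ℝ (Metric.ball 0 ε) f := hu
  have hball : Metric.ball (0 : EuclideanSpace ℝ (Fin m)) ε ∈ 𝓝 0 := Metric.ball_mem_nhds _ hε
  obtain ⟨C, t, ht, hL⟩ := hfc.locallyLipschitzOn Metric.isOpen_ball (Metric.mem_ball_self hε)
  rw [Metric.isOpen_ball.nhdsWithin_eq (Metric.mem_ball_self hε)] at ht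
  obtain ⟨C₁, t₁, ht₁, hL₁⟩ := hu.exists_lipschitzOnWith hε
  obtain ⟨C₂, t₂, ht₂, hL₂⟩ := exists_lipschitzOnWith_horoPoint ht₁ hL₁
  obtain ⟨r, hr, hrs⟩ := Metric.nhds_basis_closedBall.mem_iff.1
    (inter_mem hball (inter_mem ht ht₂))
  have hX := ConvexOn.hausdorffMeasure_not_second_order_eq_zero
    (isCompact_closedBall (0 : EuclideanSpace ℝ (Fin m)) r)
    (hfc.subset (fun x hx => (hrs hx).1) (convex_closedBall _ _))
    (hL.mono fun x hx => (hrs hx).2.1)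
  rw [finrank_euclideanSpace_fin] at hX
  set N := {x ∈ interior (Metric.closedBall (0 : EuclideanSpace ℝ (Fin m)) r) |
    ¬ ∃ (g : EuclideanSpace ℝ (Fin m)) (B : EuclideanSpace ℝ (Fin m) →L[ℝ]
      EuclideanSpace ℝ (Fin m)), HasGradientAt f g x ∧
        (fun y => f y - (f x + inner ℝ g (y - x) + (1 / 2) * inner ℝ (B (y - x)) (y - x)))
          =o[𝓝 x] fun y => ‖y - x‖ ^ 2} with hN
  set j : EuclideanSpace ℝ (Fin m) → HypSpace m := fun x => horoPoint x (u x) with hj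
  have hjN : Measure.hausdorffMeasure (m : ℝ) (j '' N) = 0 := by
    have h1 := (hL₂.mono (s := N) fun x hx =>
      (hrs (interior_subset hx.1)).2.2).hausdorffMeasure_image_le (d := m) (Nat.cast_nonneg _)
    rw [hX, mul_zero] at h1
    exact le_antisymm h1 zero_le
  refine ⟨φ ⁻¹' (U ∩ {p | p.x ∈ Metric.ball 0 r}), ?_, ?_⟩
  · refine φ.continuous.continuousAt.preimage_mem_nhds ?_
    rw [hφq]
    refine inter_mem (hU.mem_nhds ?_) (continuous_x.continuousAt.preimage_mem_nhds
      (Metric.ball_mem_nhds _ hr))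
    have := (hgr.ge ⟨0, Metric.mem_ball_self hε, rfl⟩).2
    simpa only [hu0] using this
  · have h2 : Measure.hausdorffMeasure (m : ℝ) (φ ⁻¹' (j '' N)) = 0 := by
      rw [φ.hausdorffMeasure_preimage, hjN]
    refine measure_mono_null ?_ h2
    rintro p ⟨⟨hpK, hbad⟩, hpU, hpr⟩
    have hpfr : φ p ∈ frontier (φ '' K) := by rw [hfr]; exact ⟨p, hpK, rfl⟩
    obtain ⟨x, hx, hxp⟩ := hgr.le ⟨hpfr, hpU⟩
    have hxr : x ∈ Metric.ball 0 r := by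
      have h3 : (φ p).x ∈ Metric.ball 0 r := hpr
      rwa [← hxp] at h3
    refine ⟨x, ⟨Metric.ball_subset_interior_closedBall hxr, ?_⟩, hxp⟩
    rintro ⟨g, B, hg, hexp⟩
    refine hbad (hK.isNormalPoint hpK (fun P P' hP hP' => ?_) ?_)
    · refine φ.injective.image_injective ?_
      have hpx : (φ p).x = x := by rw [← hxp]; rfl
      refine (hP.image φ).eq_of_hasGradientAt (f := f) (g := g) (by rwa [hpx]) ?_ ?_ (hP'.image φ)
      · rw [hpx, ← hxp]
        exact klein_horoPoint x (u x)
      · rw [hpx]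
        filter_upwards [Metric.isOpen_ball.mem_nhds hx] with y hy
        exact ⟨horoPoint y (u y), hK'.isCompact.isClosed.frontier_subset
          (hgr.ge ⟨y, hy, rfl⟩).1, klein_horoPoint y (u y)⟩
    · have h4 := hasSecondOrderContact_horoPoint hU hgr hx hexp
      have h5 : horoPoint x (u x) = φ p := hxp
      rw [h5] at h4
      have h6 := h4.image hφ.symm
      rw [hfr, φ.symm_apply_apply, Set.image_image] at h6
      simpa using h6

end

theorem proposition3p1 (m : ℕ) (K : Set (HypSpace m)) (hK : IsHypConvexBody K) :
    MeasureTheory.Measure.hausdorffMeasure (m : ℝ)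
      {q : HypSpace m | q ∈ frontier K ∧ ¬ IsNormalPoint K q} = 0 := by
  refine MeasureTheory.measure_null_of_locally_null _ fun q hq => ?_
  obtain ⟨W, hW, h0⟩ := hK.exists_nhds_hausdorffMeasure_eq_zero hq.1
  exact ⟨_, Filter.inter_mem self_mem_nhdsWithin (mem_nhdsWithin_of_mem_nhds hW), h0⟩
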